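/- **Conventions.** Let $\mathfrak s=\mathfrak s_1\dots\mathfrak s_{m+n}$ be a parity sequence, i.e. a sequence of $m$ zeros and $n$ ones, and write $\bar\imath=\mathfrak s_i$. The Yangian $\mathrm Y(\mathfrak{gl}^{\mathfrak s}_{m|n})$ is the $\mathbb Z_2$-graded associative algebra over $\mathbb C$ with generators $t_{ij}^{(r)}$ of parity $\bar\imath+\bar\jmath$ ($1\le i,j\le m+n$, $r\ge 1$) and the defining relations $$(u-v)\,[t_{ij}(u),t_{kl}(v)]=\big(t_{kj}(u)\,t_{il}(v)-t_{kj}(v)\,t_{il}(u)\big)(-1)^{\bar\imath\bar\jmath+\bar\imath\bar k+\bar\jmath\bar k},$$ where $[\cdot,\cdot]$ is the supercommutator and $t_{ij}(u)=\delta_{ij}+\sum_{r\ge1}t_{ij}^{(r)}u^{-r}$. For a tuple $\lambda(u)=(\lambda_1(u),\dots,\lambda_{m+n}(u))$ of series $\lambda_i(u)\in1+u^{-1}\mathbb C[[u^{-1}]]$, the Verma module $M(\lambda(u))$ associated with $\mathfrak s$ is the quotient of $\mathrm Y(\mathfrak{gl}^{\mathfrak s}_{m|n})$ by the left ideal generated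 by all coefficients of $t_{ij}(u)$ with $i<j$ and of $t_{ii}(u)-\lambda_i(u)$ for all $i$, and $L(\lambda(u))$ is its irreducible quotient, that is, its quotient by the sum of all proper submodules. For a permutation $\sigma$ of $\{1,\dots,m+n\}$ and $\mathfrak s'_a=\mathfrak s_{\sigma(a)}$, the algebras $\mathrm Y(\mathfrak{gl}^{\mathfrak s'}_{m|n})$ and $\mathrm Y(\mathfrak{gl}^{\mathfrak s}_{m|n})$ are isomorphic via $t_{ab}(u)\mapsto t_{\sigma(a)\sigma(b)}(u)$. **Statement.** Let $\lambda(u)$ be a tuple of series as above, let $1\le i<m+n$, and suppose that $\mathfrak s_i\mathfrak s_{i+1}$ is $01$ or $10$. Suppose that $$\lambda_i(u)=\prod_{r=1}^k\big(1+\lambda_i^{(r)}u^{-1}\big),\qquad \lambda_{i+1}(u)=\prod_{r=1}^k\big(1+\lambda_{i+1}^{(r)}u^{-1}\big)$$ for some $k\ge0$ and some complex numbers $\lambda_i^{(r)},\lambda_{i+1}^{(r)}$ (zero values are allowed) such that $\lambda_i^{(r)}\ne\lambda_{i+1}^{(q)}$ for all $r,q\in\{1,\dots,k\}$. Define $\lambda^{\pm}(u)$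 by $$\lambda^{\pm}_i(u)=\prod_{r=1}^k\big(1+(\lambda_{i+1}^{(r)}\pm1)u^{-1}\big),\qquad \lambda^{\pm}_{i+1}(u)=\prod_{r=1}^k\big(1+(\lambda_{i}^{(r)}\pm1)u^{-1}\big),$$ and $\lambda^\pm_j(u)=\lambda_j(u)$ for $j\ne i,i+1$. If $\mathfrak s_i\mathfrak s_{i+1}=10$, let $\mathfrak s^+$ be the sequence obtained from $\mathfrak s$ by replacing this subsequence with $01$; if $\mathfrak s_i\mathfrak s_{i+1}=01$, let $\mathfrak s^-$ be the sequence obtained from $\mathfrak s$ by replacing this subsequence with $10$. Identify $\mathrm Y(\mathfrak{gl}^{\mathfrak s^\pm}_{m|n})$ with $\mathrm Y(\mathfrak{gl}^{\mathfrak s}_{m|n})$ by the re-labelling isomorphism for the transposition $\sigma=(i,i+1)$. Then the module $L(\lambda(u))$ associated with $\mathfrak s$ is isomorphic to the module $L(\lambda^{+}(u))$ associated with $\mathfrak s^{+}$ if $\mathfrak s_i\mathfrak s_{i+1}=10$, and to the module $L(\lambda^{-}(u))$ associated with $\mathfrak s^{-}$ if $\mathfrak s_i\mathfrak s_{i+1}=01$.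 (Isomorphisms of modules are not required to preserve a $\mathbb Z_2$-grading.) -/

import Mathlib

open scoped PowerSeries

namespace SuperYangian

/-- The sign `(-1)^p` of a parity `p`. -/
def sgn (p : ZMod 2) : ℂ := if p = 0 then 1 else -1

/-- The elements `t_{ij}^{(r)}` of the free algebra, for all `r ≥ 0`: `t_{ij}^{(0)} = δ_{ij}`, and
for `r ≥ 1` the `t_{ij}^{(r)}` are the free generators (`t_{ij}^{(r+1)}` has the index
`(i, j, r)`). -/
noncomputable def freeT {N : ℕ} (i j : Fin N) : ℕ → FreeAlgebra ℂ (Fin N × Fin N × ℕ)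
  | 0 => if i = j then 1 else 0
  | r + 1 => FreeAlgebra.ι ℂ (i, j, r)

/-- The supercommutator `[t_{ij}^{(r)}, t_{kl}^{(q)}]`, where `t_{ij}^{(r)}` has parity
`s i + s j`. -/
noncomputable def superComm {N : ℕ} (s : Fin N → ZMod 2) (i j : Fin N) (r : ℕ)
    (k l : Fin N) (q : ℕ) : FreeAlgebra ℂ (Fin N × Fin N × ℕ) :=
  freeT i j r * freeT k l q - sgn ((s i + s j) * (s k + s l)) • (freeT k l q * freeT i j r)

/-- The defining relations of the Yangian: the coefficients at `u^{-r} v^{-q}` of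
`(u - v) [t_{ij}(u), t_{kl}(v)]
  = (t_{kj}(u) t_{il}(v) - t_{kj}(v) t_{il}(u)) (-1)^{s_i s_j + s_i s_k + s_j s_k}`,
where `t_{ij}(u) = δ_{ij} + ∑_{r ≥ 1} t_{ij}^{(r)} u^{-r}`. (The coefficients at `u v^{-q}` and
`u^{-r} v` say `0 = 0`, because `t_{ij}^{(0)}` is a scalar.) -/
inductive Rel {N : ℕ} (s : Fin N → ZMod 2) :
    FreeAlgebra ℂ (Fin N × Fin N × ℕ) → FreeAlgebra ℂ (Fin N × Fin N × ℕ) → Prop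
  | rtt (i j k l : Fin N) (r q : ℕ) :
      Rel s (superComm s i j (r + 1) k l q - superComm s i j r k l (q + 1))
        (sgn (s i * s j + s i * s k + s j * s k) •
          (freeT k j r * freeT i l q - freeT k j q * freeT i l r))

/-- The Yangian `Y(gl^s_{m|n})` of the parity sequence `s = s_1 … s_N`; here `m` is the number of
zeros and `n` the number of ones in `s`, so that `N = m + n`. -/
def Yangian {N : ℕ} (s : Fin N → ZMod 2) : Type := RingQuot (Rel s)

noncomputable instance {N : ℕ} (s : Fin N → ZMod 2) : Ring (Yangian s) :=
  inferInstanceAs (Ring (RingQuot (Rel s)))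

noncomputable instance {N : ℕ} (s : Fin N → ZMod 2) : Algebra ℂ (Yangian s) :=
  inferInstanceAs (Algebra ℂ (RingQuot (Rel s)))

/-- The projection from the free algebra to the Yangian. -/
noncomputable def Yangian.mk {N : ℕ} (s : Fin N → ZMod 2) :
    FreeAlgebra ℂ (Fin N × Fin N × ℕ) →ₐ[ℂ] Yangian s :=
  RingQuot.mkAlgHom ℂ (Rel s)

theorem Yangian.mk_rel {N : ℕ} {s : Fin N → ZMod 2} {x y : FreeAlgebra ℂ (Fin N × Fin N × ℕ)}
    (h : Rel s x y) : Yangian.mk s x = Yangian.mk s y :=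
  RingQuot.mkAlgHom_rel ℂ h

/-- The element `t_{ij}^{(r)}` of the Yangian, `r ≥ 0`. -/
noncomputable def Yangian.t {N : ℕ} (s : Fin N → ZMod 2) (i j : Fin N) (r : ℕ) : Yangian s :=
  Yangian.mk s (freeT i j r)

/-- The map of free algebras `t_{ij}^{(r)} ↦ t_{σ(i)σ(j)}^{(r)}`. -/
noncomputable def freeRelabel {N : ℕ} (σ : Equiv.Perm (Fin N)) :
    FreeAlgebra ℂ (Fin N × Fin N × ℕ) →ₐ[ℂ] FreeAlgebra ℂ (Fin N × Fin N × ℕ) :=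
  FreeAlgebra.lift ℂ fun x => freeT (σ x.1) (σ x.2.1) (x.2.2 + 1)

theorem freeRelabel_freeT {N : ℕ} (σ : Equiv.Perm (Fin N)) (i j : Fin N) (r : ℕ) :
    freeRelabel σ (freeT i j r) = freeT (σ i) (σ j) r := by
  cases r with
  | zero => by_cases h : i = j <;> simp [freeT, h]
  | succ r => simp [freeT, freeRelabel]

/-- The re-labelling homomorphism `t_{ij}^{(r)} ↦ t_{σ(i)σ(j)}^{(r)}` from `Y(gl^{s'})` to
`Y(gl^s)`, where `s'_a = s_{σ(a)}`. -/
noncomputable def relabelHom {N : ℕ} (s s' : Fin N → ZMod 2) (σ : Equiv.Perm (Fin N))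
    (h : ∀ a, s' a = s (σ a)) : Yangian s' →ₐ[ℂ] Yangian s :=
  RingQuot.liftAlgHom ℂ ⟨(Yangian.mk s).comp (freeRelabel σ), by
    rintro _ _ ⟨i, j, k, l, r, q⟩
    have key : ∀ (a b : Fin N) (n : ℕ), (Yangian.mk s).comp (freeRelabel σ) (freeT a b n)
        = Yangian.mk s (freeT (σ a) (σ b) n) := fun a b n =>
      congrArg (Yangian.mk s) (freeRelabel_freeT σ a b n)
    have := Yangian.mk_rel (Rel.rtt (s := s) (σ i) (σ j) (σ k) (σ l) r q)
    simp only [superComm, map_sub, map_mul, map_smul] at this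
    simp only [superComm, map_sub, map_mul, map_smul, key, h, this]⟩

theorem relabelHom_t {N : ℕ} (s s' : Fin N → ZMod 2) (σ : Equiv.Perm (Fin N))
    (h : ∀ a, s' a = s (σ a)) (i j : Fin N) (r : ℕ) :
    relabelHom s s' σ h (Yangian.t s' i j r) = Yangian.t s (σ i) (σ j) r := by
  have : relabelHom s s' σ h (Yangian.t s' i j r)
      = Yangian.mk s (freeRelabel σ (freeT i j r)) :=
    RingQuot.liftAlgHom_mkAlgHom_apply ℂ _ _ _
  rw [this, freeRelabel_freeT]; rfl

theorem Yangian.algHom_ext {N : ℕ} {s : Fin N → ZMod 2} {A : Type} [Ring A] [Algebra ℂ A]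
    {f g : Yangian s →ₐ[ℂ] A} (h : ∀ i j r, f (Yangian.t s i j r) = g (Yangian.t s i j r)) :
    f = g := by
  refine RingQuot.ringQuot_ext' ℂ f g (FreeAlgebra.hom_ext ?_)
  funext x
  exact h x.1 x.2.1 (x.2.2 + 1)

/-- The re-labelling isomorphism `t_{ij}^{(r)} ↦ t_{σ(i)σ(j)}^{(r)}` from `Y(gl^{s ∘ σ})` to
`Y(gl^s)`. -/
noncomputable def relabel {N : ℕ} (s : Fin N → ZMod 2) (σ : Equiv.Perm (Fin N)) :
    Yangian (s ∘ σ) ≃ₐ[ℂ] Yangian s :=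
  AlgEquiv.ofAlgHom (relabelHom s (s ∘ σ) σ fun _ => rfl)
    (relabelHom (s ∘ σ) s σ.symm fun a => by simp)
    (Yangian.algHom_ext fun i j r => by simp [relabelHom_t])
    (Yangian.algHom_ext fun i j r => by simp [relabelHom_t])

/-- The left ideal generated by the coefficients of `t_{ij}(u)`, `i < j`, and of
`t_{ii}(u) - λ_i(u)`. The series `λ_i(u)` is a power series in the variable `u^{-1}`. -/
noncomputable def vermaIdeal {N : ℕ} (s : Fin N → ZMod 2) (lam : Fin N → ℂ⟦X⟧) :
    Submodule (Yangian s) (Yangian s) :=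
  Submodule.span (Yangian s)
    ({x | ∃ (i j : Fin N) (r : ℕ), i < j ∧ x = Yangian.t s i j r} ∪
     {x | ∃ (i : Fin N) (r : ℕ),
        x = Yangian.t s i i r - algebraMap ℂ (Yangian s) (PowerSeries.coeff r (lam i))})

/-- The Verma module `M(λ(u))` over `Y(gl^s)`. -/
abbrev Verma {N : ℕ} (s : Fin N → ZMod 2) (lam : Fin N → ℂ⟦X⟧) : Type :=
  Yangian s ⧸ vermaIdeal s lam

/-- The sum of all proper submodules of the Verma module; it is the unique maximal proper
submodule. -/
noncomputable def maxSubmodule {N : ℕ} (s : Fin N → ZMod 2) (lam : Fin N → ℂ⟦X⟧) :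
    Submodule (Yangian s) (Verma s lam) :=
  sSup {P | P ≠ ⊤}

/-- The irreducible quotient `L(λ(u))` of the Verma module `M(λ(u))`. -/
abbrev IrrModule {N : ℕ} (s : Fin N → ZMod 2) (lam : Fin N → ℂ⟦X⟧) : Type :=
  Verma s lam ⧸ maxSubmodule s lam

/-- The polynomial `(1 + a_1 u^{-1}) … (1 + a_k u^{-1})` as a power series in `u^{-1}`. -/
noncomputable def linProd {k : ℕ} (a : Fin k → ℂ) : ℂ⟦X⟧ :=
  ∏ r, (1 + PowerSeries.C (a r) * PowerSeries.X)

/-- The tuple of series obtained from `λ(u)` by replacing the `i`-th component by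
`∏ (1 + (b_r + c) u^{-1})` and the `j`-th one by `∏ (1 + (a_r + c) u^{-1})`. When
`λ_i(u) = ∏ (1 + a_r u^{-1})`, `λ_j(u) = ∏ (1 + b_r u^{-1})` and `j = i + 1`, this is `λ^+(u)`
for `c = 1` and `λ^-(u)` for `c = -1`. -/
noncomputable def reflectedWeight {N k : ℕ} (lam : Fin N → ℂ⟦X⟧) (i j : Fin N)
    (a b : Fin k → ℂ) (c : ℂ) : Fin N → ℂ⟦X⟧ :=
  Function.update (Function.update lam i (linProd fun r => b r + c)) j (linProd fun r => a r + c)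

/-- The `Y(gl^s)`-module `V` and the `Y(gl^{s ∘ σ})`-module `W` are isomorphic when the Yangians
are identified by the re-labelling isomorphism: `V`, regarded as a `Y(gl^{s ∘ σ})`-module through
`t_{ab}(u) ↦ t_{σ(a)σ(b)}(u)`, is isomorphic to `W`. -/
def IsoViaRelabel {N : ℕ} (s : Fin N → ZMod 2) (σ : Equiv.Perm (Fin N)) (V W : Type)
    [AddCommGroup V] [Module ℂ V] [Module (Yangian s) V]
    [AddCommGroup W] [Module ℂ W] [Module (Yangian (s ∘ σ)) W] : Prop :=
  ∃ f : V ≃ₗ[ℂ] W, ∀ (y : Yangian (s ∘ σ)) (x : V), f (relabel s σ y • x) = y • f x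

end SuperYangian

/-!
Write `j = i + 1`, `ε = (-1)^{s_i}`, `A = t_{ii}`, `D = t_{jj}`, `B = t_{ij}`, `C = t_{ji}`, and let
`v` be the highest weight vector of `V = L(λ(u))`. The module `V` is simple, and it is enough to
find in it a nonzero vector `w` of highest weight `λ^±(u)` for the reflected order of the indices:
then `V` is a simple quotient of the Verma module of `λ^±(u)`, hence isomorphic to `L(λ^±(u))`.

Weight considerations, for the operators `cartan`, need no PBW theorem, only that words in the
generators applied to a singular vector can be rewritten without raising generators
(`IsSingular.reach`). They show that every raising series but `B(u)` annihilates the span of the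
words in the coefficients of `C(u)` applied to `v` (`IsHighestWeight.apply_lowered_eq_zero`), and
that singular vectors of lower weight vanish. As a consequence `u^k C(u)`, `u^k A(u)` and `u^k D(u)`
act on this span by polynomials in `u`.

The quadratic relation of the odd series `C(u)` yields a nonzero combination of words of some length
`p` annihilated by `C(u)` (`IsOddCurrent.exists_ker`), and a joint eigenvector `w` of the diagonal
series among the vectors of this kind is a highest weight vector for the reflected order. Since its
weight space is a line, all words of length `p` are multiples of `w`.

It remains to find the eigenvalues `α'(u)`, `β'(u)` of `A(u)`, `D(u)` on `w`. Let `α(u)`, `β(u)` be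
those on `v`. On all words, `C(u + ε) (α(u) D(u) - β(u) A(u)) = 0` (`IsExchange.revEval_ratio`).
Since `A(u + ε) C(u) = C(u + ε) A(u)`, and likewise for `D`, this gives
`(α(u) D(u + ε) - β(u) A(u + ε)) C(u) = 0`, so that `α(u) β'(u + ε) = β(u) α'(u + ε)`. The
polynomials `u^k α(u)` and `u^k β(u)` are coprime by the hypothesis on their roots, and all four
polynomials are monic of degree `k`; hence `u^k α'(u)` and `u^k β'(u)` are `u^k α(u)` and `u^k β(u)`
with `u` replaced by `u - ε`.
-/

open scoped PowerSeries

namespace SuperYangian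

/-! ### Representations by operators, and the span of lowering words -/

/-- The operators `t i j r` on `V` satisfy the defining relations of `Y(gl^s)`, that is, they are
the images of the `t_{ij}^{(r)}` under a representation. Stating everything for families of
operators rather than for modules makes the passage to `s ∘ σ` a mere change of indices. -/
structure IsRep {N : ℕ} {V : Type*} [AddCommGroup V] [Module ℂ V] (s : Fin N → ZMod 2)
    (t : Fin N → Fin N → ℕ → Module.End ℂ V) : Prop where
  zero : ∀ i j, t i j 0 = if i = j then 1 else 0
  rtt : ∀ i j k l r q,
    (t i j (r + 1) * t k l q - sgn ((s i + s j) * (s k + s l)) • (t k l q * t i j (r + 1)))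
      - (t i j r * t k l (q + 1) - sgn ((s i + s j) * (s k + s l)) • (t k l (q + 1) * t i j r))
      = sgn (s i * s j + s i * s k + s j * s k) • (t k j r * t i l q - t k j q * t i l r)

section Rep

variable {N : ℕ} {V : Type*} [AddCommGroup V] [Module ℂ V] {s : Fin N → ZMod 2}
  {t : Fin N → Fin N → ℕ → Module.End ℂ V}

theorem sgn_zero : sgn 0 = 1 := by simp [sgn]

theorem sgn_one : sgn 1 = -1 := by simp [sgn]

theorem sgn_mul_self (p : ZMod 2) : sgn p * sgn p = 1 := by
  unfold sgn; split_ifs <;> norm_num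

theorem IsRep.zero_self (h : IsRep s t) (i : Fin N) : t i i 0 = 1 := by simp [h.zero]

theorem IsRep.zero_of_ne (h : IsRep s t) {i j : Fin N} (hij : i ≠ j) : t i j 0 = 0 := by
  simp [h.zero, hij]

theorem IsRep.relabel (h : IsRep s t) (σ : Equiv.Perm (Fin N)) :
    IsRep (s ∘ σ) fun a b r => t (σ a) (σ b) r where
  zero i j := by simp [h.zero]
  rtt i j k l r q := h.rtt (σ i) (σ j) (σ k) (σ l) r q

/-- A subspace stable under all the operators, i.e. a subrepresentation. -/
def IsStable (t : Fin N → Fin N → ℕ → Module.End ℂ V) (W : Submodule ℂ V) : Prop :=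
  ∀ i j r, ∀ x ∈ W, t i j r x ∈ W

/-- `v` generates the representation. -/
def IsCyclicVector (t : Fin N → Fin N → ℕ → Module.End ℂ V) (v : V) : Prop :=
  ∀ W : Submodule ℂ V, IsStable t W → v ∈ W → W = ⊤

/-- `x` is annihilated by all the coefficients of `t_{ij}(u)` with `i < j`. -/
def IsSingular (t : Fin N → Fin N → ℕ → Module.End ℂ V) (x : V) : Prop :=
  ∀ i j r, i < j → t i j r x = 0

/-- `Reach t p x d y`: the vector `y` is a combination of words applied to `x`, in letters
`t_{ij}^{(r)}`, `r ≥ 1`, with `p i j`, such that the upper indices in each word add up to at most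
`d`. -/
inductive Reach (t : Fin N → Fin N → ℕ → Module.End ℂ V) (p : Fin N → Fin N → Prop) (x : V) :
    ℕ → V → Prop
  | base (d : ℕ) : Reach t p x d x
  | zero (d : ℕ) : Reach t p x d 0
  | add {d : ℕ} {y z : V} : Reach t p x d y → Reach t p x d z → Reach t p x d (y + z)
  | smul {d : ℕ} (c : ℂ) {y : V} : Reach t p x d y → Reach t p x d (c • y)
  | op {d e : ℕ} (i j : Fin N) (r : ℕ) {y : V} : p i j → Reach t p x d y → d + (r + 1) ≤ e →
      Reach t p x e (t i j (r + 1) y)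

theorem Reach.mono {p : Fin N → Fin N → Prop} {x y : V} {d e : ℕ} (h : Reach t p x d y)
    (hde : d ≤ e) : Reach t p x e y := by
  induction h generalizing e with
  | base d => exact .base e
  | zero d => exact .zero e
  | add _ _ h1 h2 => exact .add (h1 hde) (h2 hde)
  | smul c _ h1 => exact .smul c (h1 hde)
  | op i j r hp h1 h2 _ => exact .op i j r hp h1 (h2.trans hde)

theorem Reach.sub {p : Fin N → Fin N → Prop} {x y z : V} {d : ℕ} (h : Reach t p x d y)
    (h' : Reach t p x d z) : Reach t p x d (y - z) := by
  have := h.add (h'.smul (-1))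
  simpa [sub_eq_add_neg] using this

theorem Reach.op' (hr : IsRep s t) {p : Fin N → Fin N → Prop} {x y : V} {d : ℕ} {i j : Fin N}
    (hp : p i j) (r : ℕ) (h : Reach t p x d y) : Reach t p x (d + r) (t i j r y) := by
  cases r with
  | zero =>
    by_cases hij : i = j
    · subst hij; simpa [hr.zero_self] using h
    · simpa [hr.zero_of_ne hij] using Reach.zero d
  | succ r => exact .op i j r hp h le_rfl

/-- A superbracket of two generators is a combination of products whose upper indices add up to one
less: telescope the defining relation down to `t_{ij}^{(0)}`, which is a scalar. -/
theorem IsRep.reach_superBracket (hr : IsRep s t) {x y : V} {d : ℕ}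
    (h : Reach t (fun _ _ => True) x d y) (i j k l : Fin N) (r q : ℕ) :
    Reach t (fun _ _ => True) x (d + r + q - 1)
      (t i j r (t k l q y) - sgn ((s i + s j) * (s k + s l)) • t k l q (t i j r y)) := by
  induction r generalizing q with
  | zero =>
    by_cases hij : i = j
    · subst hij
      simpa [hr.zero_self, CharTwo.add_self_eq_zero, sgn_zero] using Reach.zero _
    · simpa [hr.zero_of_ne hij] using Reach.zero _
  | succ r ih =>
    have e := congrArg (fun f : Module.End ℂ V => f y) (hr.rtt i j k l r q)
    simp only [LinearMap.sub_apply, LinearMap.smul_apply, Module.End.mul_apply] at e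
    rw [sub_eq_iff_eq_add] at e
    rw [e]
    refine (Reach.smul _ (Reach.sub ?_ ?_)).add ?_
    · exact ((h.op' hr (i := i) (j := l) trivial q).op'
         hr (i := k) (j := j) trivial r).mono (by omega)
    · exact ((h.op' hr (i := i) (j := l) trivial r).op'
         hr (i := k) (j := j) trivial q).mono (by omega)
    · exact (ih (q + 1)).mono (by omega)

/-- On a singular vector, words in all the generators can be rewritten as words in the generators
`t_{ij}^{(r)}` with `j ≤ i`: move a raising letter to the right, the superbrackets having lower
degree. This replaces the triangular decomposition from the PBW theorem. -/
theorem IsSingular.reach (hr : IsRep s t) {x : V} (hx : IsSingular t x) :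
    ∀ (d : ℕ) (y : V), Reach t (fun _ _ => True) x d y → Reach t (fun i j => j ≤ i) x d y := by
  intro d
  induction d using Nat.strong_induction_on with
  | _ d ih =>
  intro y hy
  induction hy with
  | base d => exact .base d
  | zero d => exact .zero d
  | add _ _ h1 h2 => exact .add (h1 ih) (h2 ih)
  | smul c _ h1 => exact .smul c (h1 ih)
  | @op d' d i j r y _ hy hd _ =>
    have hG := ih d' (by omega) y hy
    clear hy
    by_cases hij : j ≤ i
    · exact .op i j r hij hG hd
    push Not at hij
    suffices H : ∀ d₁ z, Reach t (fun i j => j ≤ i) x d₁ z → d₁ + (r + 1) ≤ d →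
        Reach t (fun i j => j ≤ i) x (d₁ + (r + 1)) (t i j (r + 1) z) from
      (H d' y hG hd).mono hd
    intro d₁ z hz
    induction hz with
    | base d₁ => intro _; rw [hx i j _ hij]; exact .zero _
    | zero d₁ => intro _; rw [map_zero]; exact .zero _
    | add _ _ h1 h2 => intro hh; rw [map_add]; exact .add (h1 hh) (h2 hh)
    | smul c _ h1 => intro hh; rw [map_smul]; exact .smul c (h1 hh)
    | @op d₂ d₁ k l q z hkl hz hd₂ h1 =>
      intro hh
      have hz' : Reach t (fun _ _ => True) x d₂ z := by
        clear h1 hd₂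
        induction hz with
        | base d => exact .base d
        | zero d => exact .zero d
        | add _ _ h1 h2 => exact .add h1 h2
        | smul c _ h1 => exact .smul c h1
        | op i j r _ _ h2 h3 => exact .op i j r trivial h3 h2
      have hb := ih _ (by omega) _ (hr.reach_superBracket hz' i j k l (r + 1) (q + 1))
      have h2 : Reach t (fun i j => j ≤ i) x (d₁ + (r + 1)) (t k l (q + 1) (t i j (r + 1) z)) :=
        .op k l q hkl (h1 (by omega)) (by omega)
      have := (hb.mono (e := d₁ + (r + 1)) (by omega)).add
        (h2.smul (sgn ((s i + s j) * (s k + s l))))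
      simpa using this

/-- A subspace that contains a singular cyclic vector and is stable under the generators
`t_{ij}^{(r)}` with `j ≤ i` is everything. -/
theorem IsSingular.eq_top (hr : IsRep s t) {x : V} (hx : IsSingular t x)
    (hcyc : IsCyclicVector t x) {S : Submodule ℂ V} (hxS : x ∈ S)
    (hS : ∀ i j r, j ≤ i → ∀ y ∈ S, t i j r y ∈ S) : S = ⊤ := by
  let W : Submodule ℂ V :=
    { carrier := {y | ∃ d, Reach t (fun _ _ => True) x d y}
      add_mem' := by
        rintro y z ⟨d, hy⟩ ⟨e, hz⟩
        exact ⟨max d e, (hy.mono (le_max_left _ _)).add (hz.mono (le_max_right _ _))⟩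
      zero_mem' := ⟨0, .zero 0⟩
      smul_mem' := by
        rintro c y ⟨d, hy⟩
        exact ⟨d, hy.smul c⟩ }
  have hW : W = ⊤ := by
    refine hcyc W ?_ ⟨0, .base 0⟩
    rintro i j r y ⟨d, hy⟩
    exact ⟨d + r, hy.op' hr trivial r⟩
  rw [eq_top_iff, ← hW]
  rintro y ⟨d, hy⟩
  have := hx.reach hr d y hy
  clear hy
  induction this with
  | base d => exact hxS
  | zero d => exact S.zero_mem
  | add _ _ h1 h2 => exact S.add_mem h1 h2
  | smul c _ h1 => exact S.smul_mem c h1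
  | op i j r h _ _ h3 => exact hS i j _ h _ h3

/-! ### Weights -/

/-- The element `∑ c_a (-1)^{s_a} t_{aa}^{(1)}` of the Cartan subalgebra of `gl^s` with integral
coefficients `c`; the bracket with it multiplies `t_{kl}^{(q)}` by `c_k - c_l`. -/
noncomputable def cartan (s : Fin N → ZMod 2) (t : Fin N → Fin N → ℕ → Module.End ℂ V)
    (c : Fin N → ℤ) : Module.End ℂ V :=
  ∑ a, ((c a : ℂ) * sgn (s a)) • t a a 1

theorem IsRep.cartan_mul (hr : IsRep s t) (c : Fin N → ℤ) (k l : Fin N) (q : ℕ) :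
    cartan s t c * t k l q = t k l q * cartan s t c + ((c k - c l : ℤ) : ℂ) • t k l q := by
  have key : ∀ a, t a a 1 * t k l q - t k l q * t a a 1
      = sgn (s a) • ((if a = k then t k l q else 0) - (if a = l then t k l q else 0)) := by
    intro a
    have e := hr.rtt a a k l 0 q
    have e1 : sgn (s a * s a + s a * s k + s a * s k) = sgn (s a) := by
      rw [add_assoc, CharTwo.add_self_eq_zero, add_zero]
      generalize s a = p
      congr 1; revert p; decide
    rw [e1] at e
    simp only [CharTwo.add_self_eq_zero, zero_mul, sgn_zero, one_smul, hr.zero_self, zero_add,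
      one_mul, mul_one, sub_self, sub_zero, hr.zero] at e
    rw [e]
    by_cases h1 : a = k <;> by_cases h2 : a = l <;> subst_vars <;> simp_all [eq_comm]
  rw [← sub_eq_iff_eq_add', cartan, Finset.sum_mul, Finset.mul_sum, ← Finset.sum_sub_distrib]
  simp only [smul_mul_assoc, mul_smul_comm, ← smul_sub, key, smul_smul, mul_assoc, sgn_mul_self,
    mul_one]
  simp only [smul_sub, Finset.sum_sub_distrib, smul_ite, smul_zero, Finset.sum_ite_eq',
    Finset.mem_univ, if_true, ← sub_smul]
  push_cast
  rfl

theorem IsRep.mem_eigenspace (hr : IsRep s t) {c : Fin N → ℤ} {k l : Fin N} {q : ℕ} {μ ν : ℂ}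
    {x : V} (hx : x ∈ (cartan s t c).eigenspace μ) (hν : ν = μ + ((c k - c l : ℤ) : ℂ)) :
    t k l q x ∈ (cartan s t c).eigenspace ν := by
  rw [Module.End.mem_eigenspace_iff] at hx ⊢
  have := congrArg (fun f : Module.End ℂ V => f x) (hr.cartan_mul c k l q)
  simp only [LinearMap.add_apply, LinearMap.smul_apply, Module.End.mul_apply, hx, map_smul] at this
  rw [this, hν, add_smul]

theorem disjoint_eigenspace_iSup {f : Module.End ℂ V} {ι : Type*} {g : ι → ℂ} {μ : ℂ}
    (h : ∀ n, g n ≠ μ) : Disjoint (f.eigenspace μ) (⨆ n, f.eigenspace (g n)) := by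
  refine (f.eigenspaces_iSupIndep μ).mono_right ?_
  exact iSup_le fun n => le_iSup₂_of_le (g n) (h n) le_rfl

/-- For antitone `c` the weights of a representation generated by a singular weight vector lie
below its weight. -/
theorem IsSingular.iSup_eigenspace (hr : IsRep s t) {x : V} (hx : IsSingular t x)
    (hcyc : IsCyclicVector t x) {c : Fin N → ℤ} (hc : Antitone c) {μ : ℂ}
    (hμ : x ∈ (cartan s t c).eigenspace μ) :
    ⨆ n : ℕ, (cartan s t c).eigenspace (μ - n) = ⊤ := by
  refine hx.eq_top hr hcyc (Submodule.mem_iSup_of_mem 0 (by simpa using hμ)) ?_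
  intro i j r hij y hy
  have : ∀ y ∈ ⨆ n : ℕ, (cartan s t c).eigenspace (μ - n),
      y ∈ (⨆ n : ℕ, (cartan s t c).eigenspace (μ - n)).comap (t i j r) := by
    rw [← SetLike.le_def]
    refine iSup_le fun n y hy => ?_
    obtain ⟨m, hm⟩ := Int.le.dest (hc hij)
    refine Submodule.mem_iSup_of_mem (n + m) (hr.mem_eigenspace hy ?_)
    rw [← hm]; push_cast; ring
  exact this y hy

theorem IsSingular.eq_zero_of_higher (hr : IsRep s t) {x : V} (hx : IsSingular t x)
    (hcyc : IsCyclicVector t x) {c : Fin N → ℤ} (hc : Antitone c) {μ : ℂ}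
    (hμ : x ∈ (cartan s t c).eigenspace μ) {d : ℤ} (hd : 0 < d) {y : V}
    (hy : y ∈ (cartan s t c).eigenspace (μ + d)) : y = 0 := by
  have hdis := disjoint_eigenspace_iSup (f := cartan s t c) (g := fun n : ℕ => μ - n) (μ := μ + d)
    (fun n hn => by
      have : ((-(n : ℤ) : ℤ) : ℂ) = (d : ℂ) := by push_cast; linear_combination hn
      have := Int.cast_injective this
      omega)
  rw [hx.iSup_eigenspace hr hcyc hc hμ, disjoint_top] at hdis
  rw [hdis] at hy
  simpa using hy

/-- `v` is a singular vector on which `t_{aa}(u)` acts by the series `λ_a(u)`. It may be zero. -/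
structure IsHighestWeight (t : Fin N → Fin N → ℕ → Module.End ℂ V) (lam : Fin N → ℂ⟦X⟧) (v : V) :
    Prop where
  singular : IsSingular t v
  diag : ∀ a r, t a a r v = PowerSeries.coeff r (lam a) • v

theorem IsHighestWeight.exists_cartan {lam : Fin N → ℂ⟦X⟧} {v : V}
    (h : IsHighestWeight t lam v) (s : Fin N → ZMod 2) (c : Fin N → ℤ) :
    ∃ μ, v ∈ (cartan s t c).eigenspace μ := by
  refine ⟨∑ a, ((c a : ℂ) * sgn (s a)) * PowerSeries.coeff 1 (lam a), ?_⟩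
  rw [Module.End.mem_eigenspace_iff, cartan, LinearMap.sum_apply, Finset.sum_smul]
  simp [h.diag, smul_smul]

/-- For strictly antitone `c`, the highest weight vector spans the top weight space modulo the
lower ones. -/
theorem IsHighestWeight.span_sup_eq_top (hr : IsRep s t) {lam : Fin N → ℂ⟦X⟧} {v : V}
    (h : IsHighestWeight t lam v) (hcyc : IsCyclicVector t v) {c : Fin N → ℤ} (hc : StrictAnti c)
    {μ : ℂ} (hμ : v ∈ (cartan s t c).eigenspace μ) :
    ℂ ∙ v ⊔ ⨆ n : ℕ, (cartan s t c).eigenspace (μ - (n + 1)) = ⊤ := by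
  refine h.singular.eq_top hr hcyc
    (Submodule.mem_sup_left (Submodule.mem_span_singleton_self v)) ?_
  intro i j r hij
  set S := ℂ ∙ v ⊔ ⨆ n : ℕ, (cartan s t c).eigenspace (μ - (n + 1)) with hS
  suffices S ≤ S.comap (t i j r) from fun y hy => this hy
  nth_rw 1 [hS]
  refine sup_le ?_ (iSup_le fun n y hy => ?_)
  · rw [Submodule.span_singleton_le_iff_mem, Submodule.mem_comap]
    rcases hij.eq_or_lt with rfl | hij
    · rw [h.diag]
      exact S.smul_mem _ (Submodule.mem_sup_left (Submodule.mem_span_singleton_self v))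
    · obtain ⟨m, hm⟩ := Int.le.dest (hc hij)
      refine Submodule.mem_sup_right (Submodule.mem_iSup_of_mem m (hr.mem_eigenspace hμ ?_))
      rw [← hm]; push_cast; ring
  · obtain ⟨m, hm⟩ := Int.le.dest (hc.antitone hij)
    refine Submodule.mem_sup_right (Submodule.mem_iSup_of_mem (n + m) (hr.mem_eigenspace hy ?_))
    rw [← hm]; push_cast; ring

theorem disjoint_lower (f : Module.End ℂ V) (μ : ℂ) :
    Disjoint (f.eigenspace μ) (⨆ n : ℕ, f.eigenspace (μ - (n + 1))) :=
  disjoint_eigenspace_iSup fun n hn => by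
    have : ((n + 1 : ℕ) : ℂ) = 0 := by push_cast; linear_combination -hn
    exact Nat.succ_ne_zero n (Nat.cast_injective (R := ℂ) (by simpa using this))

/-- The weight space of the highest weight vector is one-dimensional. -/
theorem IsHighestWeight.mem_span (hr : IsRep s t) {lam : Fin N → ℂ⟦X⟧} {v : V}
    (h : IsHighestWeight t lam v) (hcyc : IsCyclicVector t v) {c : Fin N → ℤ} (hc : StrictAnti c)
    {μ : ℂ} (hμ : v ∈ (cartan s t c).eigenspace μ) {y : V}
    (hy : y ∈ (cartan s t c).eigenspace μ) : y ∈ ℂ ∙ v := by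
  have hy' : y ∈ (⊤ : Submodule ℂ V) := trivial
  rw [← h.span_sup_eq_top hr hcyc hc hμ, Submodule.mem_sup] at hy'
  obtain ⟨x, hx, z, hz, rfl⟩ := hy'
  have hx' : x ∈ (cartan s t c).eigenspace μ :=
    (Submodule.span_singleton_le_iff_mem _ _).2 hμ hx
  have hz' := ((Submodule.add_mem_iff_right _ hx').1 hy)
  have := (Submodule.disjoint_def.1 (disjoint_lower (cartan s t c) μ)) z hz' hz
  simpa [this] using hx

/-- Proper subrepresentations have only weights strictly below the highest one. -/
theorem IsHighestWeight.le_lower (hr : IsRep s t) {lam : Fin N → ℂ⟦X⟧} {v : V}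
    (h : IsHighestWeight t lam v) (hcyc : IsCyclicVector t v) {c : Fin N → ℤ} (hc : StrictAnti c)
    {μ : ℂ} (hμ : v ∈ (cartan s t c).eigenspace μ) {P : Submodule ℂ V} (hP : IsStable t P)
    (hne : P ≠ ⊤) : P ≤ ⨆ n : ℕ, (cartan s t c).eigenspace (μ - (n + 1)) := by
  set f := cartan s t c with hf
  set S := ⨆ n : ℕ, f.eigenspace (μ - (n + 1)) with hS
  have hPf : ∀ x ∈ P, f x ∈ P := by
    intro x hx
    rw [hf, cartan, LinearMap.sum_apply]
    exact P.sum_mem fun a _ => P.smul_mem _ (hP a a 1 x hx)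
  intro x hx
  have hx' : x ∈ (⊤ : Submodule ℂ V) := trivial
  rw [← h.span_sup_eq_top hr hcyc hc hμ, Submodule.mem_sup] at hx'
  obtain ⟨y, hy, z, hz, rfl⟩ := hx'
  obtain ⟨α, rfl⟩ := Submodule.mem_span_singleton.1 hy
  by_cases hα : α = 0
  · simpa [hα] using hz
  exfalso
  refine hne (hcyc P hP ?_)
  -- the images of `v` and `z` in `V ⧸ P` are opposite up to a scalar and have distinct weights
  let g : Module.End ℂ (V ⧸ P) := P.mapQ P f hPf
  have hge : ∀ ν y, y ∈ f.eigenspace ν → P.mkQ y ∈ g.eigenspace ν := by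
    intro ν y hy
    rw [Module.End.mem_eigenspace_iff] at hy ⊢
    simp [g, hy]
  have h1 : P.mkQ z ∈ ⨆ n : ℕ, g.eigenspace (μ - (n + 1)) := by
    have : S ≤ (⨆ n : ℕ, g.eigenspace (μ - (n + 1))).comap P.mkQ :=
      iSup_le fun n y hy => Submodule.mem_iSup_of_mem n (hge _ _ hy)
    exact this hz
  have h2 : P.mkQ (α • v) = - P.mkQ z := by
    rw [← add_eq_zero_iff_eq_neg, ← map_add]
    exact (Submodule.Quotient.mk_eq_zero P).2 hx
  have h3 : P.mkQ (α • v) = 0 :=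
    Submodule.disjoint_def.1 (disjoint_lower g μ) _ (hge _ _ (Submodule.smul_mem _ _ hμ))
      (h2 ▸ Submodule.neg_mem _ h1)
  have h4 : α • v ∈ P := (Submodule.Quotient.mk_eq_zero P).1 h3
  exact (P.smul_mem_iff hα).1 h4

end Rep

/-! ### Joint eigenvectors -/

/-- By induction on the dimension of `K`: unless all operators are scalars on `K`, pass to a proper
eigenspace of one of them. -/
theorem exists_joint_eigenvector {V ι : Type*} [AddCommGroup V] [Module ℂ V]
    (f : ι → Module.End ℂ V) (K : Submodule ℂ V) [FiniteDimensional ℂ K] (hK : K ≠ ⊥)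
    (hf : ∀ i, ∀ x ∈ K, f i x ∈ K)
    (hcomm : ∀ i j, ∀ x ∈ K, f i (f j x) = f j (f i x)) :
    ∃ w ∈ K, w ≠ 0 ∧ ∀ i, ∃ c : ℂ, f i w = c • w := by
  induction hn : Module.finrank ℂ K using Nat.strong_induction_on generalizing K with
  | _ n ih =>
  by_cases hs : ∀ i, ∃ c : ℂ, ∀ x ∈ K, f i x = c • x
  · obtain ⟨w, hw, hw0⟩ := K.exists_mem_ne_zero_of_ne_bot hK
    exact ⟨w, hw, hw0, fun i => (hs i).imp fun c hc => hc w hw⟩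
  push Not at hs
  obtain ⟨i, hi⟩ := hs
  have : Nontrivial K := Submodule.nontrivial_iff_ne_bot.2 hK
  obtain ⟨c, hc⟩ := Module.End.exists_eigenvalue ((f i).restrict (hf i))
  obtain ⟨⟨w, hwK⟩, hw⟩ := hc.exists_hasEigenvector
  have hw1 : f i w = c • w := by simpa [Subtype.ext_iff] using hw.apply_eq_smul
  have hw0 : w ≠ 0 := fun h0 => hw.2 (by simpa using h0)
  obtain ⟨x, hxK, hx⟩ := hi c
  let K' := K ⊓ (f i).eigenspace c
  have hlt : K' < K := lt_of_le_of_ne inf_le_left fun h => hx (by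
    have : x ∈ K' := h ▸ hxK
    exact Module.End.mem_eigenspace_iff.1 this.2)
  have : FiniteDimensional ℂ K' := Submodule.finiteDimensional_of_le hlt.le
  obtain ⟨w', hw', h⟩ := ih _ (hn ▸ Submodule.finrank_lt_finrank_of_lt hlt) K'
    (fun h => hw0 (by
      have : w ∈ K' := ⟨hwK, Module.End.mem_eigenspace_iff.2 hw1⟩
      rw [h] at this; simpa using this))
    (fun j y hy => ⟨hf j y hy.1, Module.End.mem_eigenspace_iff.2 <| by
      rw [hcomm i j y hy.1,
        Module.End.mem_eigenspace_iff.1 hy.2, map_smul]⟩)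
    (fun j l y hy => hcomm j l y hy.1) rfl
  exact ⟨w', hw'.1, h⟩

/-! ### Truncated series in the inverse variable as polynomials -/

section RevEval

variable {V W : Type*} [AddCommGroup V] [Module ℂ V] [AddCommGroup W] [Module ℂ W]

/-- The value at `u = z` of `u^k ∑ f_r u^{-r}`, the sum being cut off at `r = k`; for series in
`u^{-1}` with `f_r = 0` for `r > k` nothing is lost. -/
def revEval (k : ℕ) (z : ℂ) (f : ℕ → V) : V := ∑ r ∈ Finset.range (k + 1), z ^ (k - r) • f r

theorem revEval_add (k : ℕ) (z : ℂ) (f g : ℕ → V) :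
    revEval k z (fun r => f r + g r) = revEval k z f + revEval k z g := by
  simp [revEval, Finset.sum_add_distrib]

theorem revEval_sub (k : ℕ) (z : ℂ) (f g : ℕ → V) :
    revEval k z (fun r => f r - g r) = revEval k z f - revEval k z g := by
  simp [revEval, smul_sub]

theorem revEval_smul (k : ℕ) (z c : ℂ) (f : ℕ → V) :
    revEval k z (fun r => c • f r) = c • revEval k z f := by
  simp only [revEval, Finset.smul_sum]
  exact Finset.sum_congr rfl fun r _ => smul_comm _ _ _

theorem map_revEval (φ : V →ₗ[ℂ] W) (k : ℕ) (z : ℂ) (f : ℕ → V) :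
    φ (revEval k z f) = revEval k z fun r => φ (f r) := by
  simp [revEval]

theorem revEval_apply (k : ℕ) (z : ℂ) (E : ℕ → Module.End ℂ V) (x : V) :
    revEval k z E x = revEval k z fun r => E r x := by
  simp [revEval]

theorem revEval_apply_revEval_apply (k : ℕ) (z y : ℂ) (E C : ℕ → Module.End ℂ V) (x : V) :
    revEval k z E (revEval k y C x) = revEval k z fun r => revEval k y fun q => E r (C q x) := by
  simp only [revEval_apply]
  congr 1; funext r
  exact map_revEval _ _ _ _

theorem revEval_smul_const (k : ℕ) (z : ℂ) (f : ℕ → ℂ) (x : V) :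
    revEval k z (fun r => f r • x) = revEval k z f • x := by
  simp [revEval, Finset.sum_smul, smul_smul]

theorem revEval_comm (k : ℕ) (z y : ℂ) (X : ℕ → ℕ → V) :
    revEval k z (fun r => revEval k y fun q => X r q)
      = revEval k y fun q => revEval k z fun r => X r q := by
  simp only [revEval, Finset.smul_sum]
  rw [Finset.sum_comm]
  exact Finset.sum_congr rfl fun r _ => Finset.sum_congr rfl fun q _ => smul_comm _ _ _

theorem revEval_mem {K : Submodule ℂ V} {k : ℕ} {z : ℂ} {f : ℕ → V} (h : ∀ r, f r ∈ K) :
    revEval k z f ∈ K :=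
  K.sum_mem fun r _ => K.smul_mem _ (h r)

theorem smul_revEval {k : ℕ} {f : ℕ → V} (h0 : f 0 = 0) (hk : f (k + 1) = 0) (z : ℂ) :
    z • revEval k z f = revEval k z fun r => f (r + 1) := by
  rw [revEval, revEval, Finset.sum_range_succ' _ k, Finset.sum_range_succ _ k, h0, hk, smul_zero,
    smul_zero, add_zero, add_zero, Finset.smul_sum]
  refine Finset.sum_congr rfl fun r hr => ?_
  rw [smul_smul, ← pow_succ']
  congr 2
  have := Finset.mem_range.1 hr
  omega

/-- The passage from relations between coefficients, with the left-hand side of the defining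
relations, to relations between polynomials in `z` and `y`. -/
theorem sub_smul_revEval_revEval {k : ℕ} {X Y : ℕ → ℕ → V}
    (h : ∀ r q, X (r + 1) q - X r (q + 1) = Y r q) (hl : ∀ q, X 0 q = 0) (hr : ∀ r, X r 0 = 0)
    (hl' : ∀ q, X (k + 1) q = 0) (hr' : ∀ r, X r (k + 1) = 0) (z y : ℂ) :
    (z - y) • revEval k z (fun r => revEval k y (X r))
      = revEval k z fun r => revEval k y (Y r) := by
  have h1 : z • revEval k z (fun r => revEval k y (X r))
      = revEval k z fun r => revEval k y (X (r + 1)) :=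
    smul_revEval (by simp [hl, revEval]) (by simp [hl', revEval]) z
  have h2 : y • revEval k z (fun r => revEval k y (X r))
      = revEval k z fun r => revEval k y fun q => X r (q + 1) := by
    rw [← revEval_smul]
    congr 1; funext r
    exact smul_revEval (hr r) (hr' r) y
  rw [sub_smul, h1, h2, ← revEval_sub]
  congr 1; funext r
  rw [← revEval_sub]
  congr 1; funext q
  exact h r q

open Polynomial in
/-- The polynomial `∑_{r ≤ k} f_r X^{k-r}`, whose values are given by `revEval`. -/
noncomputable def revPoly (k : ℕ) (f : ℕ → ℂ) : ℂ[X] :=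
  ∑ r ∈ Finset.range (k + 1), C (f r) * X ^ (k - r)

theorem eval_revPoly (k : ℕ) (f : ℕ → ℂ) (z : ℂ) : (revPoly k f).eval z = revEval k z f := by
  simp only [revPoly, revEval, Polynomial.eval_finsetSum, Polynomial.eval_mul, Polynomial.eval_C,
    Polynomial.eval_pow, Polynomial.eval_X, smul_eq_mul]
  exact Finset.sum_congr rfl fun r _ => mul_comm _ _

theorem coeff_revPoly {k : ℕ} (f : ℕ → ℂ) {r : ℕ} (hr : r ≤ k) :
    (revPoly k f).coeff (k - r) = f r := by
  rw [revPoly, Polynomial.finsetSum_coeff, Finset.sum_eq_single r]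
  · simp
  · intro q hq hqr
    have := Finset.mem_range.1 hq
    rw [Polynomial.coeff_C_mul, Polynomial.coeff_X_pow, if_neg (by omega), mul_zero]
  · intro h; exact absurd (Finset.mem_range.2 (by omega)) h

theorem natDegree_revPoly_le (k : ℕ) (f : ℕ → ℂ) : (revPoly k f).natDegree ≤ k :=
  Polynomial.natDegree_sum_le_of_forall_le _ _ fun _ _ =>
    (Polynomial.natDegree_C_mul_X_pow_le _ _).trans (Nat.sub_le _ _)

theorem revPoly_monic (k : ℕ) {f : ℕ → ℂ} (h : f 0 = 1) : (revPoly k f).Monic :=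
  Polynomial.monic_of_natDegree_le_of_coeff_eq_one k (natDegree_revPoly_le k f)
    (by simpa [h] using coeff_revPoly f (Nat.zero_le k))

theorem natDegree_revPoly (k : ℕ) {f : ℕ → ℂ} (h : f 0 = 1) : (revPoly k f).natDegree = k :=
  (natDegree_revPoly_le k f).antisymm (Polynomial.le_natDegree_of_ne_zero (by
    have := coeff_revPoly f (Nat.zero_le k)
    simp only [Nat.sub_zero, h] at this
    simp [this]))

theorem eq_zero_of_revEval_eq_zero {k : ℕ} {f : ℕ → V} {s : Set ℂ} (hs : s.Finite)
    (h : ∀ y ∉ s, revEval k y f = 0) {r : ℕ} (hr : r ≤ k) : f r = 0 := by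
  rw [← Module.forall_dual_apply_eq_zero_iff ℂ]
  intro φ
  have : revPoly k (fun r => φ (f r)) = 0 := by
    refine Polynomial.eq_zero_of_infinite_isRoot _ (hs.infinite_compl.mono fun y hy => ?_)
    change Polynomial.eval _ _ = 0
    rw [eval_revPoly, ← map_revEval, h y hy, map_zero]
  rw [← coeff_revPoly (fun r => φ (f r)) hr, this, Polynomial.coeff_zero]

theorem linProd_succ {k : ℕ} (a : Fin (k + 1) → ℂ) :
    linProd a = (1 + PowerSeries.C (a 0) * PowerSeries.X) * linProd fun r : Fin k => a r.succ := by
  simp [linProd, Fin.prod_univ_succ]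

theorem coeff_zero_linProd {k : ℕ} (a : Fin k → ℂ) : PowerSeries.coeff 0 (linProd a) = 1 := by
  simp [linProd]

theorem coeff_succ_linProd_succ {k : ℕ} (a : Fin (k + 1) → ℂ) (r : ℕ) :
    PowerSeries.coeff (r + 1) (linProd a)
      = PowerSeries.coeff (r + 1) (linProd fun r : Fin k => a r.succ)
        + a 0 * PowerSeries.coeff r (linProd fun r : Fin k => a r.succ) := by
  rw [linProd_succ, add_mul, one_mul, mul_assoc, map_add, PowerSeries.coeff_C_mul,
    PowerSeries.coeff_succ_X_mul]

theorem coeff_linProd_of_lt {k : ℕ} (a : Fin k → ℂ) {r : ℕ} (h : k < r) :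
    PowerSeries.coeff r (linProd a) = 0 := by
  induction k generalizing r with
  | zero => simp [linProd, PowerSeries.coeff_one, (Nat.pos_iff_ne_zero.1 h)]
  | succ k ih =>
    obtain ⟨r, rfl⟩ : ∃ q, r = q + 1 := ⟨r - 1, by omega⟩
    rw [coeff_succ_linProd_succ, ih _ (by omega), ih _ (by omega)]
    simp

theorem revEval_coeff_linProd {k : ℕ} (a : Fin k → ℂ) (z : ℂ) :
    revEval k z (fun r => PowerSeries.coeff r (linProd a)) = ∏ r, (z + a r) := by
  induction k with
  | zero => simp [revEval, linProd]
  | succ k ih =>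
    set F := fun r => PowerSeries.coeff r (linProd fun r : Fin k => a r.succ) with hF
    have hk : F (k + 1) = 0 := coeff_linProd_of_lt _ (Nat.lt_succ_self k)
    have h0 : F 0 = 1 := coeff_zero_linProd _
    have hz : z * revEval k z F = z ^ (k + 1) + revEval k z fun r => F (r + 1) := by
      simp only [revEval, smul_eq_mul]
      rw [Finset.sum_range_succ', Finset.sum_range_succ (fun r => z ^ (k - r) * F (r + 1)), hk, h0,
        mul_add, Finset.mul_sum, mul_zero, add_zero, mul_one, Nat.sub_zero, ← pow_succ', add_comm]
      congr 1
      refine Finset.sum_congr rfl fun r hr => ?_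
      have := Finset.mem_range.1 hr
      rw [← mul_assoc, ← pow_succ']
      congr 2; omega
    rw [Fin.prod_univ_succ, ← ih, add_mul, hz, revEval, Finset.sum_range_succ', coeff_zero_linProd,
      add_comm, Nat.sub_zero, smul_eq_mul, mul_one, add_assoc]
    congr 1
    simp only [coeff_succ_linProd_succ]
    rw [← smul_eq_mul (a 0), ← revEval_smul, ← revEval_add, revEval]
    refine Finset.sum_congr rfl fun r hr => ?_
    rw [Nat.add_sub_add_right]; rfl

open Polynomial in
theorem revPoly_coeff_linProd {k : ℕ} (a : Fin k → ℂ) :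
    revPoly k (fun r => PowerSeries.coeff r (linProd a)) = ∏ r, (X + C (a r)) :=
  Polynomial.funext fun z => by
    rw [eval_revPoly, revEval_coeff_linProd, Polynomial.eval_prod]; simp

open Polynomial in
/-- If `P(u) β(u + ε) = Q(u) α(u + ε)` for coprime `P = ∏ (u + a_r)`, `Q = ∏ (u + b_r)` and monic
`α`, `β` of the same degree, then `α(u) = P(u - ε)` and `β(u) = Q(u - ε)`. -/
theorem eq_coeff_linProd_of_comp_mul_eq {k : ℕ} {a b : Fin k → ℂ} (hab : ∀ r q, a r ≠ b q)
    {α β : ℕ → ℂ} (hα : α 0 = 1) (hα' : ∀ r, k < r → α r = 0)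
    (hβ' : ∀ r, k < r → β r = 0) (ε : ℂ)
    (h : (∏ r, (X + C (a r))) * (revPoly k β).comp (X + C ε)
      = (∏ r, (X + C (b r))) * (revPoly k α).comp (X + C ε)) :
    (∀ r, α r = PowerSeries.coeff r (linProd fun q => a q - ε)) ∧
      ∀ r, β r = PowerSeries.coeff r (linProd fun q => b q - ε) := by
  have hcop : IsCoprime (∏ r, (X + C (a r))) (∏ r, (X + C (b r))) := by
    refine IsCoprime.prod_left fun r _ => IsCoprime.prod_right fun q _ => ?_
    have := Polynomial.isCoprime_X_sub_C_of_isUnit_sub (R := ℂ) (a := -a r) (b := -b q)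
      (IsUnit.mk0 _ fun h0 => hab r q (by linear_combination -h0))
    simpa using this
  have hdeg : ∀ c : Fin k → ℂ, (∏ r, (X + C (c r))).Monic ∧ (∏ r, (X + C (c r))).natDegree = k := by
    intro c
    rw [← revPoly_coeff_linProd]
    exact ⟨revPoly_monic k (coeff_zero_linProd c), natDegree_revPoly k (coeff_zero_linProd c)⟩
  have hαm : ((revPoly k α).comp (X + C ε)).Monic := (revPoly_monic k hα).comp_X_add_C ε
  have hα1 : (revPoly k α).comp (X + C ε) = ∏ r, (X + C (a r)) :=
    Polynomial.eq_of_monic_of_dvd_of_natDegree_le (hdeg a).1 hαm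
      (hcop.dvd_of_dvd_mul_left (Dvd.intro _ h))
      (by rw [(hdeg a).2, Polynomial.natDegree_comp, natDegree_revPoly k hα]; simp)
  have hβ1 : (revPoly k β).comp (X + C ε) = ∏ r, (X + C (b r)) := by
    rw [hα1, mul_comm] at h
    exact mul_right_cancel₀ (hdeg a).1.ne_zero h
  have key : ∀ {γ : ℕ → ℂ} {c : Fin k → ℂ}, (∀ r, k < r → γ r = 0) →
      (revPoly k γ).comp (X + C ε) = ∏ r, (X + C (c r)) →
      ∀ r, γ r = PowerSeries.coeff r (linProd fun q => c q - ε) := by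
    intro γ c hγ hc r
    rcases lt_or_ge k r with hr | hr
    · rw [hγ r hr, coeff_linProd_of_lt _ hr]
    · rw [← coeff_revPoly γ hr, ← coeff_revPoly (fun r => PowerSeries.coeff r _) hr]
      congr 1
      refine Polynomial.funext fun z => ?_
      have := congrArg (Polynomial.eval (z - ε)) hc
      rw [revPoly_coeff_linProd]
      simpa [Polynomial.eval_comp, Polynomial.eval_prod, sub_add_eq_add_sub, add_sub_assoc] using this
  exact ⟨key hα' hα1, key hβ' hβ1⟩

end RevEval

/-! ### Currents of type `gl(1|1)` -/

section OddLowering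

variable {V : Type*} [AddCommGroup V] [Module ℂ V] {C E : ℕ → Module.End ℂ V} {ε : ℂ} {k : ℕ}
  {v : V}

/-- The coefficients of the relation
`(u - v) (C(u) C(v) + C(v) C(u)) = -ε (C(u) C(v) - C(v) C(u))`, which `C(u) = t_{ji}(u)` satisfies
when `s_i ≠ s_j` and `ε = (-1)^{s_i}`. -/
structure IsOddCurrent (ε : ℂ) (C : ℕ → Module.End ℂ V) : Prop where
  zero : C 0 = 0
  rel : ∀ r q, (C (r + 1) * C q + C q * C (r + 1)) - (C r * C (q + 1) + C (q + 1) * C r)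
    = -ε • (C r * C q - C q * C r)

/-- The coefficients of the relation `(u - v) [E(u), C(v)] = ε (C(u) E(v) - C(v) E(u))`, which
holds for both `E = t_{ii}` and `E = t_{jj}` when `C = t_{ji}`, `s_i ≠ s_j` and `ε = (-1)^{s_i}`. -/
structure IsExchange (ε : ℂ) (C E : ℕ → Module.End ℂ V) : Prop where
  zero : E 0 = 1
  rel : ∀ r q, (E (r + 1) * C q - C q * E (r + 1)) - (E r * C (q + 1) - C (q + 1) * E r)
    = ε • (C r * E q - C q * E r)

theorem IsOddCurrent.rel_apply (hC : IsOddCurrent ε C) (r q : ℕ) (x : V) :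
    (C (r + 1) (C q x) + C q (C (r + 1) x)) - (C r (C (q + 1) x) + C (q + 1) (C r x))
      = -ε • (C r (C q x) - C q (C r x)) :=
  congrArg (fun f : Module.End ℂ V => f x) (hC.rel r q)

theorem IsExchange.rel_apply (hE : IsExchange ε C E) (r q : ℕ) (x : V) :
    (E (r + 1) (C q x) - C q (E (r + 1) x)) - (E r (C (q + 1) x) - C (q + 1) (E r x))
      = ε • (C r (E q x) - C q (E r x)) :=
  congrArg (fun f : Module.End ℂ V => f x) (hE.rel r q)

/-- The span of the words of length `p` in `C_0, …, C_k` applied to `v`. The bound `k` on the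
letters keeps it finite-dimensional; when `C_r v = 0` for all `r > k` the other letters act by
zero. -/
noncomputable def lowered (C : ℕ → Module.End ℂ V) (k : ℕ) (v : V) : ℕ → Submodule ℂ V
  | 0 => ℂ ∙ v
  | p + 1 => ⨆ r : Fin (k + 1), (lowered C k v p).map (C r)

theorem lowered_succ_le {p : ℕ} {S : Submodule ℂ V}
    (h : ∀ r ≤ k, ∀ x ∈ lowered C k v p, C r x ∈ S) : lowered C k v (p + 1) ≤ S :=
  iSup_le fun r => Submodule.map_le_iff_le_comap.2 fun x hx => h r (Nat.lt_succ_iff.1 r.2) x hx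

theorem finiteDimensional_lowered (C : ℕ → Module.End ℂ V) (k : ℕ) (v : V) (p : ℕ) :
    FiniteDimensional ℂ (lowered C k v p) := by
  induction p with
  | zero => exact inferInstanceAs (FiniteDimensional ℂ (ℂ ∙ v))
  | succ p ih =>
    exact inferInstanceAs
      (FiniteDimensional ℂ ↥(⨆ r : Fin (k + 1), (lowered C k v p).map (C r)))

theorem IsOddCurrent.apply_eq_zero_of_lt (hC : IsOddCurrent ε C) (hv : ∀ r, k < r → C r v = 0)
    {p : ℕ} {x : V} (hx : x ∈ lowered C k v p) {r : ℕ} (hr : k < r) : C r x = 0 := by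
  induction p generalizing x r with
  | zero =>
    obtain ⟨c, rfl⟩ := Submodule.mem_span_singleton.1 hx
    rw [map_smul, hv r hr, smul_zero]
  | succ p ih =>
    suffices lowered C k v (p + 1) ≤ LinearMap.ker (C r) from this hx
    refine lowered_succ_le fun q _ y hy => ?_
    rw [LinearMap.mem_ker]
    clear hx
    induction q generalizing r with
    | zero => simp [hC.zero]
    | succ q ihq =>
      have := hC.rel_apply r q y
      rw [ihq (Nat.lt_succ_of_lt hr) (by omega), ihq hr (by omega), ih hy hr,
        ih hy (Nat.lt_succ_of_lt hr)] at this
      simpa using this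

theorem IsOddCurrent.apply_mem_lowered (hC : IsOddCurrent ε C) (hv : ∀ r, k < r → C r v = 0)
    {p : ℕ} {x : V} (hx : x ∈ lowered C k v p) (r : ℕ) : C r x ∈ lowered C k v (p + 1) := by
  rcases lt_or_ge k r with hr | hr
  · rw [hC.apply_eq_zero_of_lt hv hx hr]; exact Submodule.zero_mem _
  · exact Submodule.mem_iSup_of_mem (⟨r, Nat.lt_succ_iff.2 hr⟩ : Fin (k + 1))
      (Submodule.mem_map_of_mem hx)

theorem IsExchange.apply_mem_lowered (hE : IsExchange ε C E) (hC : IsOddCurrent ε C)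
    (hv : ∀ r, k < r → C r v = 0) (hEv : ∀ r, E r v ∈ ℂ ∙ v) {p : ℕ} {x : V}
    (hx : x ∈ lowered C k v p) (r : ℕ) : E r x ∈ lowered C k v p := by
  induction p generalizing x r with
  | zero =>
    obtain ⟨c, rfl⟩ := Submodule.mem_span_singleton.1 hx
    rw [map_smul]
    exact Submodule.smul_mem _ _ (hEv r)
  | succ p ih =>
    suffices lowered C k v (p + 1) ≤ (lowered C k v (p + 1)).comap (E r) from this hx
    refine lowered_succ_le fun q _ y hy => ?_
    rw [Submodule.mem_comap]
    clear hx
    induction q generalizing r with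
    | zero => simp [hC.zero]
    | succ q ihq =>
      have e : E r (C (q + 1) y) = E (r + 1) (C q y) - C q (E (r + 1) y) + C (q + 1) (E r y)
          - ε • (C r (E q y) - C q (E r y)) := by
        rw [← hE.rel_apply]; abel
      rw [e]
      have hm := fun a b => hC.apply_mem_lowered hv (ih hy a) b
      exact Submodule.sub_mem _ (Submodule.add_mem _ (Submodule.sub_mem _ (ihq _ (by omega)) (hm _ _))
        (hm _ _)) (Submodule.smul_mem _ _ (Submodule.sub_mem _ (hm _ _) (hm _ _)))

theorem IsExchange.apply_eq_zero_of_lt (hE : IsExchange ε C E) (hC : IsOddCurrent ε C)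
    (hv : ∀ r, k < r → C r v = 0) (hEv : ∀ r, E r v ∈ ℂ ∙ v) (hEv' : ∀ r, k < r → E r v = 0)
    {p : ℕ} {x : V} (hx : x ∈ lowered C k v p) {r : ℕ} (hr : k < r) : E r x = 0 := by
  induction p generalizing x r with
  | zero =>
    obtain ⟨c, rfl⟩ := Submodule.mem_span_singleton.1 hx
    rw [map_smul, hEv' r hr, smul_zero]
  | succ p ih =>
    suffices lowered C k v (p + 1) ≤ LinearMap.ker (E r) from this hx
    refine lowered_succ_le fun q _ y hy => ?_
    rw [LinearMap.mem_ker]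
    clear hx
    induction q generalizing r with
    | zero => simp [hC.zero]
    | succ q ihq =>
      have := hE.rel_apply r q y
      rw [ihq (Nat.lt_succ_of_lt hr) (by omega), ih hy hr, ih hy (Nat.lt_succ_of_lt hr),
        hC.apply_eq_zero_of_lt hv (hE.apply_mem_lowered hC hv hEv hy q) hr] at this
      simpa using this

theorem IsOddCurrent.apply_apply_eq_zero (hC : IsOddCurrent ε C) {x : V} {m : ℕ}
    (hx : ∀ r ≤ m, C r x = 0) (q : ℕ) {r : ℕ} (hr : r ≤ m) : C r (C q x) = 0 := by
  induction r generalizing q with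
  | zero => simp [hC.zero]
  | succ r ih =>
    have := hC.rel_apply r q x
    rw [ih _ (by omega), ih _ (by omega), hx r (by omega), hx (r + 1) hr] at this
    simpa using this

/-- The source of singular vectors for the reflected order. The words are not sorted, and the
length `p` is not determined. -/
theorem IsOddCurrent.exists_ker (hC : IsOddCurrent ε C) (hv : ∀ r, k < r → C r v = 0)
    (hv0 : v ≠ 0) : ∃ p, ∃ x ∈ lowered C k v p, x ≠ 0 ∧ ∀ r, C r x = 0 := by
  -- If `C_0, …, C_m` annihilate `x`, then `C_0, …, C_{m+1}` annihilate `C_{m+1} x`; hence one of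
  -- `x` and `C_{m+1} x` is a nonzero vector annihilated by one more coefficient.
  suffices H : ∀ m, ∃ p, ∃ x ∈ lowered C k v p, x ≠ 0 ∧ ∀ r ≤ m, C r x = 0 by
    obtain ⟨p, x, hx, hx0, h⟩ := H k
    exact ⟨p, x, hx, hx0, fun r => (le_or_gt r k).elim (h r) (hC.apply_eq_zero_of_lt hv hx)⟩
  intro m
  induction m with
  | zero =>
    exact ⟨0, v, Submodule.mem_span_singleton_self v, hv0, fun r hr => by
      rw [Nat.le_zero.1 hr, hC.zero, LinearMap.zero_apply]⟩
  | succ m ih =>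
    obtain ⟨p, x, hx, hx0, h⟩ := ih
    by_cases h1 : C (m + 1) x = 0
    · exact ⟨p, x, hx, hx0, fun r hr => by
        rcases Nat.lt_succ_iff_lt_or_eq.1 (Nat.lt_succ_of_le hr) with hr | rfl
        · exact h r (by omega)
        · exact h1⟩
    · refine ⟨p + 1, C (m + 1) x, hC.apply_mem_lowered hv hx _, h1, fun r hr => ?_⟩
      rcases Nat.lt_succ_iff_lt_or_eq.1 (Nat.lt_succ_of_le hr) with hr | rfl
      · exact hC.apply_apply_eq_zero h _ (by omega)
      · have := hC.rel_apply m (m + 1) x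
        rw [hC.apply_apply_eq_zero h _ le_rfl, hC.apply_apply_eq_zero h _ le_rfl, h m le_rfl] at this
        simp only [map_zero, add_zero, sub_zero, smul_zero] at this
        rw [← two_smul ℂ] at this
        exact (smul_eq_zero.1 this).resolve_left two_ne_zero

/-- `(z - y) E(z) C(y) = (z - y - ε) C(y) E(z) + ε C(z) E(y)`. -/
theorem IsExchange.sub_smul (hE : IsExchange ε C E) (hC : IsOddCurrent ε C)
    (hv : ∀ r, k < r → C r v = 0) (hEv : ∀ r, E r v ∈ ℂ ∙ v) (hEv' : ∀ r, k < r → E r v = 0)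
    {p : ℕ} {x : V} (hx : x ∈ lowered C k v p) (z y : ℂ) :
    (z - y) • revEval k z E (revEval k y C x)
      = (z - y - ε) • revEval k y C (revEval k z E x) + ε • revEval k z C (revEval k y E x) := by
  have := sub_smul_revEval_revEval (k := k) (X := fun r q => E r (C q x) - C q (E r x))
    (Y := fun r q => ε • (C r (E q x) - C q (E r x))) (fun r q => hE.rel_apply r q x)
    (fun q => by simp [hE.zero]) (fun r => by simp [hC.zero])
    (fun q => by
      rw [hE.apply_eq_zero_of_lt hC hv hEv hEv' (hC.apply_mem_lowered hv hx q) (Nat.lt_succ_self k),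
        hE.apply_eq_zero_of_lt hC hv hEv hEv' hx (Nat.lt_succ_self k), map_zero, sub_zero])
    (fun r => by
      rw [hC.apply_eq_zero_of_lt hv (hE.apply_mem_lowered hC hv hEv hx r) (Nat.lt_succ_self k),
        hC.apply_eq_zero_of_lt hv hx (Nat.lt_succ_self k), map_zero, sub_zero]) z y
  simp only [revEval_sub, revEval_smul] at this
  rw [revEval_comm k z y fun r q => C q (E r x)] at this
  simp only [revEval_apply_revEval_apply]
  rw [smul_sub, sub_eq_iff_eq_add] at this
  rw [this, smul_sub, _root_.sub_smul _ ε]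
  abel

/-- `(z - y + ε) C(z) C(y) = -(z - y - ε) C(y) C(z)`. -/
theorem IsOddCurrent.add_smul (hC : IsOddCurrent ε C)
    (hv : ∀ r, k < r → C r v = 0) {p : ℕ} {x : V} (hx : x ∈ lowered C k v p) (z y : ℂ) :
    (z - y + ε) • revEval k z C (revEval k y C x)
      = -(z - y - ε) • revEval k y C (revEval k z C x) := by
  have := sub_smul_revEval_revEval (k := k) (X := fun r q => C r (C q x) + C q (C r x))
    (Y := fun r q => -ε • (C r (C q x) - C q (C r x))) (fun r q => hC.rel_apply r q x)
    (fun q => by simp [hC.zero]) (fun r => by simp [hC.zero])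
    (fun q => by
      rw [hC.apply_eq_zero_of_lt hv (hC.apply_mem_lowered hv hx q) (Nat.lt_succ_self k),
        hC.apply_eq_zero_of_lt hv hx (Nat.lt_succ_self k), map_zero, add_zero])
    (fun r => by
      rw [hC.apply_eq_zero_of_lt hv (hC.apply_mem_lowered hv hx r) (Nat.lt_succ_self k),
        hC.apply_eq_zero_of_lt hv hx (Nat.lt_succ_self k), map_zero, add_zero]) z y
  simp only [revEval_sub, revEval_add, revEval_smul] at this
  rw [revEval_comm k z y fun r q => C q (C r x)] at this
  simp only [revEval_apply_revEval_apply]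
  rw [← sub_eq_zero] at this ⊢
  rw [← this]
  module

end OddLowering

/-! ### The ratio of the diagonal eigenvalues -/

section OddLowering

variable {V : Type*} [AddCommGroup V] [Module ℂ V] {C A D : ℕ → Module.End ℂ V} {ε : ℂ} {k : ℕ}
  {v : V} {α β : ℕ → ℂ}

/-- `A(z + ε) C(z) = C(z + ε) A(z)`, the exchange relation at `z + ε` and `z`. -/
theorem IsExchange.revEval_comm_shift (hA : IsExchange ε C A) (hC : IsOddCurrent ε C) (hε : ε ≠ 0)
    (hv : ∀ r, k < r → C r v = 0) (hAv : ∀ r, A r v = α r • v) (hα : ∀ r, k < r → α r = 0)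
    {p : ℕ} {x : V} (hx : x ∈ lowered C k v p) (z : ℂ) :
    revEval k (z + ε) A (revEval k z C x) = revEval k (z + ε) C (revEval k z A x) := by
  have := hA.sub_smul hC hv
    (fun r => hAv r ▸ Submodule.smul_mem _ _ (Submodule.mem_span_singleton_self v))
    (fun r hr => by rw [hAv, hα r hr, zero_smul]) hx (z + ε) z
  rw [add_sub_cancel_left, sub_self, zero_smul, zero_add] at this
  exact smul_right_injective V hε this

/-- If `A(u)` and `D(u)` act on `v` by `α(u)` and `β(u)`, then
`C(z + ε) (α(z) D(z) - β(z) A(z)) = 0` on all words in `C` applied to `v`: the exchange relations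
for `A` and `D` have the same shape, and their unwanted terms are killed because
`C(z + ε) C(z) = 0`. -/
theorem IsExchange.revEval_ratio (hA : IsExchange ε C A) (hD : IsExchange ε C D)
    (hC : IsOddCurrent ε C) (hε : ε ≠ 0)
    (hv : ∀ r, k < r → C r v = 0) (hAv : ∀ r, A r v = α r • v) (hα : ∀ r, k < r → α r = 0)
    (hDv : ∀ r, D r v = β r • v) (hβ : ∀ r, k < r → β r = 0)
    {p : ℕ} {x : V} (hx : x ∈ lowered C k v p) (z : ℂ) :
    revEval k (z + ε) C (revEval k z α • revEval k z D x - revEval k z β • revEval k z A x) = 0 := by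
  have mem : ∀ {E : ℕ → Module.End ℂ V} {γ : ℕ → ℂ}, (∀ r, E r v = γ r • v) → ∀ r, E r v ∈ ℂ ∙ v :=
    fun h r => h r ▸ Submodule.smul_mem _ _ (Submodule.mem_span_singleton_self v)
  have van : ∀ {E : ℕ → Module.End ℂ V} {γ : ℕ → ℂ}, (∀ r, E r v = γ r • v) →
      (∀ r, k < r → γ r = 0) → ∀ r, k < r → E r v = 0 :=
    fun h h' r hr => by rw [h, h' r hr, zero_smul]
  have memE : ∀ {E : ℕ → Module.End ℂ V} {γ : ℕ → ℂ}, IsExchange ε C E → (∀ r, E r v = γ r • v) →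
      ∀ {p x}, x ∈ lowered C k v p → ∀ z, revEval k z E x ∈ lowered C k v p := by
    intro E γ hE h p x hx z
    rw [revEval_apply]
    exact revEval_mem fun r => hE.apply_mem_lowered hC hv (mem h) hx r
  have CC : ∀ {p x}, x ∈ lowered C k v p → revEval k (z + ε) C (revEval k z C x) = 0 := by
    intro p x hx
    have := hC.add_smul hv hx (z + ε) z
    rw [add_sub_cancel_left, sub_self, neg_zero, zero_smul] at this
    exact (smul_eq_zero.1 this).resolve_left (by
      rw [← two_mul]; exact mul_ne_zero two_ne_zero hε)
  induction p generalizing x with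
  | zero =>
    obtain ⟨c, rfl⟩ := Submodule.mem_span_singleton.1 hx
    have e : ∀ {E : ℕ → Module.End ℂ V} {γ : ℕ → ℂ}, (∀ r, E r v = γ r • v) →
        revEval k z E v = revEval k z γ • v := by
      intro E γ h
      rw [revEval_apply, ← revEval_smul_const]
      simp only [h]
    rw [map_smul, map_smul, e hAv, e hDv]
    rw [show revEval k z α • c • revEval k z β • v - revEval k z β • c • revEval k z α • v = 0 by
      module, map_zero]
  | succ p ih =>
    set G : Module.End ℂ V := revEval k (z + ε) C *
      (revEval k z α • revEval k z D - revEval k z β • revEval k z A) with hG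
    suffices lowered C k v (p + 1) ≤ LinearMap.ker G from this hx
    refine lowered_succ_le fun r hr y hy => ?_
    rw [LinearMap.mem_ker]
    -- The coefficient of `C(u) y` is recovered from its values at `u ≠ z, z + 2 ε`, the points at
    -- which a coefficient divided out below vanishes.
    refine eq_zero_of_revEval_eq_zero (f := fun r => G (C r y)) (s := {z, z + 2 * ε})
      (by simp) (fun u hu => ?_) hr
    simp only [Set.mem_insert_iff, Set.mem_singleton_iff, not_or] at hu
    rw [← map_revEval, ← revEval_apply]
    set y' := revEval k z α • revEval k z D y - revEval k z β • revEval k z A y with hy'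
    have hy'm : y' ∈ lowered C k v p :=
      Submodule.sub_mem _ (Submodule.smul_mem _ _ (memE hD hDv hy z))
        (Submodule.smul_mem _ _ (memE hA hAv hy z))
    have h1 : revEval k (z + ε) C (revEval k u C y') = 0 := by
      have := hC.add_smul hv hy'm (z + ε) u
      rw [ih hy, map_zero, smul_zero] at this
      exact (smul_eq_zero.1 this).resolve_left fun h => hu.2 (by linear_combination -h)
    have h2 : (z - u) • G (revEval k u C y) = 0 := by
      have e1 := hD.sub_smul hC hv (mem hDv) (van hDv hβ) hy z u
      have e2 := hA.sub_smul hC hv (mem hAv) (van hAv hα) hy z u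
      have : (z - u) • G (revEval k u C y)
          = revEval k (z + ε) C (revEval k z α • ((z - u) • revEval k z D (revEval k u C y))
            - revEval k z β • ((z - u) • revEval k z A (revEval k u C y))) := by
        rw [hG, Module.End.mul_apply, ← map_smul]
        congr 1
        simp only [LinearMap.sub_apply, LinearMap.smul_apply]
        module
      rw [this, e1, e2]
      have : revEval k z α • ((z - u - ε) • revEval k u C (revEval k z D y)
            + ε • revEval k z C (revEval k u D y))
          - revEval k z β • ((z - u - ε) • revEval k u C (revEval k z A y)
            + ε • revEval k z C (revEval k u A y))
          = (z - u - ε) • revEval k u C y' + (revEval k z α * ε) • revEval k z C (revEval k u D y)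
            - (revEval k z β * ε) • revEval k z C (revEval k u A y) := by
        rw [hy', map_sub, map_smul, map_smul]
        module
      rw [this, map_sub, map_add, map_smul, map_smul, map_smul, h1, CC (memE hD hDv hy u),
        CC (memE hA hAv hy u)]
      simp
    exact (smul_eq_zero.1 h2).resolve_left fun h => hu.1 (by linear_combination -h)

/-- On a line spanned by words in `C` of positive length, the eigenvalues `α'`, `β'` of `A`, `D`
satisfy `α(u) β'(u + ε) = β(u) α'(u + ε)`: combine the two preceding lemmas into
`(α(z) D(z + ε) - β(z) A(z + ε)) C(z) = 0`. -/
theorem IsExchange.revPoly_ratio (hA : IsExchange ε C A) (hD : IsExchange ε C D)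
    (hC : IsOddCurrent ε C) (hε : ε ≠ 0)
    (hv : ∀ r, k < r → C r v = 0) (hAv : ∀ r, A r v = α r • v) (hα : ∀ r, k < r → α r = 0)
    (hDv : ∀ r, D r v = β r • v) (hβ : ∀ r, k < r → β r = 0) {p : ℕ} {w : V} (hw0 : w ≠ 0)
    (hw : w ∈ lowered C k v (p + 1)) (hle : lowered C k v (p + 1) ≤ ℂ ∙ w) {α' β' : ℕ → ℂ}
    (hAw : ∀ r, A r w = α' r • w) (hDw : ∀ r, D r w = β' r • w) :
    revPoly k α * (revPoly k β').comp (Polynomial.X + Polynomial.C ε)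
      = revPoly k β * (revPoly k α').comp (Polynomial.X + Polynomial.C ε) := by
  obtain ⟨q, hq, x, hx, hne⟩ : ∃ q ≤ k, ∃ x ∈ lowered C k v p, C q x ≠ 0 := by
    by_contra! h
    have : lowered C k v (p + 1) ≤ ⊥ := lowered_succ_le fun r hr x hx => by simp [h r hr x hx]
    exact hw0 (by simpa using this hw)
  have : ∀ r, ∃ c : ℂ, c • w = C r x := fun r =>
    Submodule.mem_span_singleton.1 (hle (hC.apply_mem_lowered hv hx r))
  choose g hg using this
  have hg0 : revPoly k g ≠ 0 := by
    intro h
    have := coeff_revPoly g hq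
    rw [h, Polynomial.coeff_zero] at this
    exact hne (by rw [← hg, ← this, zero_smul])
  refine mul_right_cancel₀ hg0 (Polynomial.funext fun z => ?_)
  simp only [Polynomial.eval_mul, Polynomial.eval_comp, Polynomial.eval_add, Polynomial.eval_X,
    Polynomial.eval_C, eval_revPoly]
  have e : ∀ {E : ℕ → Module.End ℂ V} {γ : ℕ → ℂ} (y : ℂ), (∀ r, E r w = γ r • w) →
      revEval k y E w = revEval k y γ • w := by
    intro E γ y h
    rw [revEval_apply, ← revEval_smul_const]
    simp only [h]
  have hCx : revEval k z C x = revEval k z g • w := by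
    rw [revEval_apply, ← revEval_smul_const]
    simp only [hg]
  have h := hA.revEval_ratio hD hC hε hv hAv hα hDv hβ hx z
  rw [map_sub, map_smul, map_smul, ← hA.revEval_comm_shift hC hε hv hAv hα hx,
    ← hD.revEval_comm_shift hC hε hv hDv hβ hx, hCx, map_smul, map_smul, e _ hAw, e _ hDw,
    sub_eq_zero] at h
  simp only [smul_smul] at h
  have := smul_left_injective ℂ hw0 h
  linear_combination this

end OddLowering

section Rep

variable {N : ℕ} {V : Type*} [AddCommGroup V] [Module ℂ V] {s : Fin N → ZMod 2}
  {t : Fin N → Fin N → ℕ → Module.End ℂ V}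

/-! ### Singular vectors and simple representations -/

theorem IsRep.rtt_apply (hr : IsRep s t) (i j k l : Fin N) (r q : ℕ) (x : V) :
    (t i j (r + 1) (t k l q x) - sgn ((s i + s j) * (s k + s l)) • t k l q (t i j (r + 1) x))
      - (t i j r (t k l (q + 1) x) - sgn ((s i + s j) * (s k + s l)) • t k l (q + 1) (t i j r x))
      = sgn (s i * s j + s i * s k + s j * s k) •
        (t k j r (t i l q x) - t k j q (t i l r x)) :=
  congrArg (fun f : Module.End ℂ V => f x) (hr.rtt i j k l r q)

/-- The diagonal generators preserve singular vectors. -/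
theorem IsSingular.diag (hr : IsRep s t) {x : V} (hx : IsSingular t x) (a : Fin N) (q : ℕ) :
    IsSingular t (t a a q x) := by
  intro k l r hkl
  by_cases hka : k < a
  · induction r generalizing q with
    | zero => rw [hr.zero_of_ne hkl.ne, LinearMap.zero_apply]
    | succ r ih =>
      have := hr.rtt_apply k l a a r q x
      simpa [ih, hx k l _ hkl, hx k a _ hka] using this
  · have hal : a < l := (not_lt.1 hka).trans_lt hkl
    induction q generalizing r with
    | zero => rw [hr.zero_self, Module.End.one_apply, hx k l r hkl]
    | succ q ih =>
      have := hr.rtt_apply a a k l q r x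
      simpa [ih, hx k l _ hkl, hx a l _ hal, CharTwo.add_self_eq_zero, sgn_zero] using this

/-- The diagonal generators commute on singular vectors. -/
theorem IsSingular.diag_comm (hr : IsRep s t) {x : V} (hx : IsSingular t x) (a b : Fin N)
    (r q : ℕ) : t a a r (t b b q x) = t b b q (t a a r x) := by
  have key : ∀ a b, a ≤ b → ∀ r q, t a a r (t b b q x) = t b b q (t a a r x) := by
    intro a b hab r
    induction r with
    | zero => intro q; simp [hr.zero_self]
    | succ r ih =>
      intro q
      have := hr.rtt_apply a a b b r q x
      rcases hab.eq_or_lt with rfl | hab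
      · simpa [ih, CharTwo.add_self_eq_zero, sgn_zero, sub_eq_zero] using this
      · simpa [ih, hx a b _ hab, CharTwo.add_self_eq_zero, sgn_zero, sub_eq_zero] using this
  rcases le_total a b with h | h
  · exact key a b h r q
  · exact (key b a h q r).symm

/-- There are no subrepresentations other than `⊥` and `⊤`; the zero space is allowed. -/
def IsSimpleRep (t : Fin N → Fin N → ℕ → Module.End ℂ V) : Prop :=
  ∀ W : Submodule ℂ V, IsStable t W → W = ⊥ ∨ W = ⊤

theorem IsSimpleRep.isCyclicVector (h : IsSimpleRep t) {x : V} (hx : x ≠ 0) :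
    IsCyclicVector t x := fun W hW hxW =>
  (h W hW).resolve_left fun h0 => hx (by simpa [h0] using hxW)

theorem IsSimpleRep.relabel (h : IsSimpleRep t) (σ : Equiv.Perm (Fin N)) :
    IsSimpleRep fun a b r => t (σ a) (σ b) r := fun W hW =>
  h W fun i j r x hx => by simpa using hW (σ.symm i) (σ.symm j) r x hx

theorem cartan_relabel (s : Fin N → ZMod 2) (t : Fin N → Fin N → ℕ → Module.End ℂ V)
    (σ : Equiv.Perm (Fin N)) (c : Fin N → ℤ) :
    cartan (s ∘ σ) (fun a b r => t (σ a) (σ b) r) (c ∘ σ) = cartan s t c := by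
  simp only [cartan, Function.comp_apply]
  exact Equiv.sum_comp σ fun a => ((c a : ℂ) * sgn (s a)) • t a a 1

theorem sgn_add_one (p : ZMod 2) : sgn (p + 1) = -sgn p := by
  obtain rfl | rfl : p = 0 ∨ p = 1 := by revert p; decide
  · simp [sgn]
  · simp [sgn, CharTwo.add_self_eq_zero]

theorem sgn_ne_zero (p : ZMod 2) : sgn p ≠ 0 := by
  unfold sgn; split_ifs <;> norm_num

variable {i j : Fin N}

/-! ### The odd reflection of a highest weight vector -/

theorem IsRep.isOddCurrent (hr : IsRep s t) (hij : i ≠ j) (hs : s j = s i + 1) :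
    IsOddCurrent (sgn (s i)) (t j i) where
  zero := hr.zero_of_ne hij.symm
  rel r q := by
    have e := hr.rtt j i j i r q
    rw [show (s j + s i) * (s j + s i) = 1 by rw [hs]; generalize s i = p; revert p; decide,
      show s j * s i + s j * s j + s i * s j = s i + 1 by
        rw [hs]; generalize s i = p; revert p; decide, sgn_add_one, sgn_one] at e
    simpa [sub_eq_add_neg] using e

theorem IsRep.isExchange_left (hr : IsRep s t) : IsExchange (sgn (s i)) (t j i) (t i i) where
  zero := hr.zero_self i
  rel r q := by
    have e := hr.rtt i i j i r q
    rw [show s i * s i + s i * s j + s i * s j = s i by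
      generalize s i = p; generalize s j = p'; revert p p'; decide] at e
    simpa [CharTwo.add_self_eq_zero, sgn_zero] using e

theorem IsRep.isExchange_right (hr : IsRep s t) (hs : s j = s i + 1) :
    IsExchange (sgn (s i)) (t j i) (t j j) where
  zero := hr.zero_self j
  rel r q := by
    have e := hr.rtt j i j j q r
    rw [show s j * s i + s j * s j + s i * s j = s i + 1 by
      rw [hs]; generalize s i = p; revert p; decide, sgn_add_one] at e
    simp only [CharTwo.add_self_eq_zero, mul_zero, sgn_zero, one_smul] at e
    rw [neg_smul, ← smul_neg, neg_sub] at e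
    rw [← e]
    abel

/-- The relation between `t_{ij}(u)` and `t_{ji}(v)`. -/
theorem IsRep.odd_bracket (hr : IsRep s t) (hs : s j = s i + 1) (r q : ℕ) (x : V) :
    (t i j (r + 1) (t j i q x) + t j i q (t i j (r + 1) x))
      - (t i j r (t j i (q + 1) x) + t j i (q + 1) (t i j r x))
      = -sgn (s i) • (t j j r (t i i q x) - t j j q (t i i r x)) := by
  have e := hr.rtt_apply i j j i r q x
  rw [show (s i + s j) * (s j + s i) = 1 by rw [hs]; generalize s i = p; revert p; decide,
      show s i * s j + s i * s j + s j * s j = s i + 1 by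
        rw [hs]; generalize s i = p; revert p; decide, sgn_add_one, sgn_one] at e
  simpa [sub_eq_add_neg] using e

theorem IsRep.lowered_le_eigenspace (hr : IsRep s t) {c : Fin N → ℤ} {μ : ℂ} {v : V}
    (hv : v ∈ (cartan s t c).eigenspace μ) (k p : ℕ) :
    lowered (t j i) k v p ≤ (cartan s t c).eigenspace (μ + p * ((c j - c i : ℤ) : ℂ)) := by
  induction p with
  | zero =>
    rw [lowered, Submodule.span_singleton_le_iff_mem]
    simpa using hv
  | succ p ih =>
    refine lowered_succ_le fun r _ x hx => hr.mem_eigenspace (ih hx) ?_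
    push_cast; ring

/-- A strictly antitone coefficient vector for `cartan`. -/
def finNeg (a : Fin N) : ℤ := -(a : ℤ)

theorem finNeg_strictAnti : StrictAnti (finNeg (N := N)) := fun a b h => by
  have : (a : ℕ) < b := h
  simp only [finNeg]; omega

/-- An antitone coefficient vector for `cartan` that takes equal values at `i` and `i + 1` only. -/
def finNegMerge (i a : Fin N) : ℤ := if i < a then 1 - (a : ℤ) else -(a : ℤ)

theorem finNegMerge_antitone (i : Fin N) : Antitone (finNegMerge i) := fun a b h => by
  have : (a : ℕ) ≤ b := h
  simp only [finNegMerge, Fin.lt_def]; split_ifs <;> omega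

variable {lam : Fin N → ℂ⟦X⟧} {v : V} {k : ℕ}

/-- All raising generators except `t_{i,i+1}` annihilate the words in `t_{i+1,i}` applied to the
highest weight vector: the result would have a weight that is not below the highest one. -/
theorem IsHighestWeight.apply_lowered_eq_zero (hv : IsHighestWeight t lam v) (hr : IsRep s t)
    (hcyc : IsCyclicVector t v) (hij : (j : ℕ) = (i : ℕ) + 1) {p : ℕ} {x : V}
    (hx : x ∈ lowered (t j i) k v p) {a b : Fin N} (hab : a < b) (hne : ¬(a = i ∧ b = j)) (r : ℕ) :
    t a b r x = 0 := by
  obtain ⟨μ, hμ⟩ := hv.exists_cartan s (finNegMerge i)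
  -- With equal coefficients at `i` and `j` all these words have the weight of `v`.
  have hc : finNegMerge i j - finNegMerge i i = 0 := by
    simp only [finNegMerge, Fin.lt_def]; split_ifs <;> omega
  have hx' := hr.lowered_le_eigenspace hμ k p hx
  rw [hc, Int.cast_zero, mul_zero, add_zero] at hx'
  refine hv.singular.eq_zero_of_higher hr hcyc (finNegMerge_antitone i) hμ
    (d := finNegMerge i a - finNegMerge i b) ?_ (hr.mem_eigenspace hx' rfl)
  rw [Fin.ext_iff, Fin.ext_iff] at hne
  have : (a : ℕ) < b := hab
  simp only [finNegMerge, Fin.lt_def]; split_ifs <;> omega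

/-- If `λ_i`, `λ_{i+1}` are polynomials in `u^{-1}` of degree at most `k`, then so is
`t_{i+1,i}(u) v`: its higher coefficients are singular of lower weight, so they vanish in a simple
representation. -/
theorem IsHighestWeight.lowering_eq_zero (hv : IsHighestWeight t lam v) (hr : IsRep s t)
    (hsimple : IsSimpleRep t) (hv0 : v ≠ 0) (hij : (j : ℕ) = (i : ℕ) + 1) (hs : s j = s i + 1)
    (hi : ∀ r, k < r → PowerSeries.coeff r (lam i) = 0)
    (hj : ∀ r, k < r → PowerSeries.coeff r (lam j) = 0) (r : ℕ) (hkr : k < r) :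
    t j i r v = 0 := by
  have hlt : i < j := Fin.lt_def.2 (by omega)
  by_contra hne
  have hB : ∀ m r, k < r → t i j m (t j i r v) = 0 := by
    intro m
    induction m with
    | zero => intro r _; rw [hr.zero_of_ne hlt.ne, LinearMap.zero_apply]
    | succ m ih =>
      intro r hkr
      have := hr.odd_bracket hs m r v
      simpa [ih (r + 1) (by omega), hv.singular i j _ hlt, hv.diag, hi r hkr, hj r hkr] using this
  have hsing : IsSingular t (t j i r v) := by
    intro a b m hab
    by_cases h : a = i ∧ b = j
    · rw [h.1, h.2]; exact hB m r hkr
    · refine hv.apply_lowered_eq_zero (k := r) hr (hsimple.isCyclicVector hv0) hij (p := 1)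
        (Submodule.mem_iSup_of_mem (Fin.last r) ?_) hab h m
      exact Submodule.mem_map_of_mem (Submodule.mem_span_singleton_self v)
  obtain ⟨μ, hμ⟩ := hv.exists_cartan s finNeg
  refine hv0 (hsing.eq_zero_of_higher hr (hsimple.isCyclicVector hne) finNeg_strictAnti.antitone
    (hr.mem_eigenspace hμ rfl) one_pos ?_)
  convert hμ
  simp only [finNeg, hij]; push_cast; ring

/-- The series `t_{aa}(u)`, `a ≠ i, i + 1`, acts by `λ_a(u)` on the words in `t_{i+1,i}` applied to
`v`. -/
theorem IsHighestWeight.diag_lowered (hv : IsHighestWeight t lam v) (hr : IsRep s t)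
    (hcyc : IsCyclicVector t v) (hij : (j : ℕ) = (i : ℕ) + 1) {a : Fin N} (hai : a ≠ i)
    (haj : a ≠ j) (q : ℕ) {p : ℕ} {x : V} (hx : x ∈ lowered (t j i) k v p) :
    t a a q x = PowerSeries.coeff q (lam a) • x := by
  have hlt : i < j := Fin.lt_def.2 (by omega)
  induction p generalizing x with
  | zero =>
    obtain ⟨c, rfl⟩ := Submodule.mem_span_singleton.1 hx
    rw [map_smul, hv.diag, smul_comm]
  | succ p ih =>
    suffices lowered (t j i) k v (p + 1)
        ≤ LinearMap.ker (t a a q - PowerSeries.coeff q (lam a) • 1) by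
      simpa [sub_eq_zero] using this hx
    refine lowered_succ_le fun r _ y hy => ?_
    have hcomm : ∀ q r, t a a q (t j i r y) = t j i r (t a a q y) := by
      rcases lt_or_ge a i with h | h
      · have h0 := fun r => hv.apply_lowered_eq_zero hr hcyc hij hy h (fun h' => hai h'.1) r
        intro q
        induction q with
        | zero => intro r; simp [hr.zero_self]
        | succ q ihq =>
          intro r
          have := hr.rtt_apply a a j i q r y
          simpa [h0, ihq, CharTwo.add_self_eq_zero, sgn_zero, sub_eq_zero] using this
      · have hja : j < a := by
          rw [Fin.le_def] at h
          rw [Ne, Fin.ext_iff] at hai haj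
          rw [Fin.lt_def]; omega
        have h0 := fun r => hv.apply_lowered_eq_zero hr hcyc hij hy hja
          (fun h' => hlt.ne h'.1.symm) r
        intro q r
        induction r generalizing q with
        | zero => simp [hr.zero_of_ne hlt.ne']
        | succ r ihr =>
          have := hr.rtt_apply j i a a r q y
          simp only [h0, ihr, CharTwo.add_self_eq_zero, mul_zero, sgn_zero, one_smul, map_zero,
            sub_self, smul_zero, sub_zero] at this
          exact (sub_eq_zero.1 this).symm
    simp [hcomm, ih hy]

theorem swap_lt_swap (hij : (j : ℕ) = (i : ℕ) + 1) {a b : Fin N} (hab : a < b)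
    (hne : ¬(a = i ∧ b = j)) : Equiv.swap i j a < Equiv.swap i j b ∧
      ¬(Equiv.swap i j a = i ∧ Equiv.swap i j b = j) := by
  simp only [Fin.ext_iff, Fin.lt_def, Equiv.swap_apply_def] at *
  split_ifs <;> constructor <;> (try simp_all) <;> omega

/-- A simple representation of `Y(gl^s)` with highest weight `λ(u)` contains a highest weight
vector of the reflected weight for `Y(gl^{s ∘ σ})`, `σ = (i, i + 1)`. -/
theorem IsHighestWeight.exists_reflected (hv : IsHighestWeight t lam v) (hr : IsRep s t)
    (hsimple : IsSimpleRep t) (hv0 : v ≠ 0) (hij : (j : ℕ) = (i : ℕ) + 1) (hs : s j = s i + 1)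
    {a b : Fin k → ℂ} (hi : lam i = linProd a) (hj : lam j = linProd b) (hab : ∀ r q, a r ≠ b q) :
    ∃ w ≠ 0, IsHighestWeight (fun x y r => t (Equiv.swap i j x) (Equiv.swap i j y) r)
      (reflectedWeight lam i j a b (-sgn (s i))) w := by
  have hlt : i < j := Fin.lt_def.2 (by omega)
  have hcyc := hsimple.isCyclicVector hv0
  have hα : ∀ r, k < r → PowerSeries.coeff r (lam i) = 0 := fun r h => by
    rw [hi, coeff_linProd_of_lt _ h]
  have hβ : ∀ r, k < r → PowerSeries.coeff r (lam j) = 0 := fun r h => by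
    rw [hj, coeff_linProd_of_lt _ h]
  set σ := Equiv.swap i j with hσ
  set t' : Fin N → Fin N → ℕ → Module.End ℂ V := fun x y r => t (σ x) (σ y) r with ht'
  have hC := hr.isOddCurrent hlt.ne hs
  have hA : IsExchange (sgn (s i)) (t j i) (t i i) := hr.isExchange_left
  have hD := hr.isExchange_right hs
  have hCv := hv.lowering_eq_zero hr hsimple hv0 hij hs hα hβ
  have hmem : ∀ a r, t a a r v ∈ ℂ ∙ v := fun a r =>
    hv.diag a r ▸ Submodule.smul_mem _ _ (Submodule.mem_span_singleton_self v)
  have hzero : ∀ a, (∀ r, k < r → PowerSeries.coeff r (lam a) = 0) → ∀ r, k < r → t a a r v = 0 :=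
    fun a h r hkr => by rw [hv.diag, h r hkr, zero_smul]
  obtain ⟨p, x, hx, hx0, hCx⟩ := hC.exists_ker hCv hv0
  -- The vectors of `K` are singular for the reflected order, so the diagonal generators preserve
  -- `K` and commute on it.
  let K : Submodule ℂ V := lowered (t j i) k v p ⊓ ⨅ r, LinearMap.ker (t j i r)
  have hKmem : ∀ {x}, x ∈ K ↔ x ∈ lowered (t j i) k v p ∧ ∀ r, t j i r x = 0 := by
    intro x; simp [K]
  have hKsing : ∀ x ∈ K, IsSingular t' x := by
    intro x hx l m r hlm
    rw [hKmem] at hx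
    by_cases h : l = i ∧ m = j
    · simpa [ht', hσ, h.1, h.2] using hx.2 r
    · obtain ⟨h1, h2⟩ := swap_lt_swap hij hlm h
      exact hv.apply_lowered_eq_zero hr hcyc hij hx.1 h1 h2 r
  have hr' : IsRep (s ∘ σ) t' := hr.relabel σ
  have hfin := finiteDimensional_lowered (t j i) k v p
  have : FiniteDimensional ℂ K := Submodule.finiteDimensional_of_le inf_le_left
  obtain ⟨w, hwK, hw0, hw⟩ := exists_joint_eigenvector (fun y : Fin N × ℕ => t' y.1 y.1 y.2) K
    (fun h => hx0 (by simpa [h] using hKmem.2 ⟨hx, hCx⟩))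
    (by
      rintro ⟨c, q⟩ y hy
      refine hKmem.2 ⟨?_, fun r => ?_⟩
      · obtain ⟨c, rfl⟩ := σ.surjective c
        have hy' := (hKmem.1 hy).1
        simp only [ht', hσ, Equiv.swap_apply_self]
        by_cases hci : c = i
        · rw [hci]; exact hA.apply_mem_lowered hC hCv (hmem i) hy' q
        by_cases hcj : c = j
        · rw [hcj]; exact hD.apply_mem_lowered hC hCv (hmem j) hy' q
        rw [hv.diag_lowered hr hcyc hij hci hcj q hy']
        exact Submodule.smul_mem _ _ hy'
      · simpa [ht', hσ] using (hKsing y hy).diag hr' c q i j r hlt)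
    (fun c d y hy => (hKsing y hy).diag_comm hr' c.1 d.1 c.2 d.2)
  choose γ hγ using hw
  have hwmem := (hKmem.1 hwK).1
  have hwt : IsHighestWeight t' (fun c => PowerSeries.mk fun r => γ (c, r)) w :=
    ⟨hKsing w hwK, fun c r => by simpa using hγ (c, r)⟩
  -- All words of length `p` have the weight of `w`, and the weight space of the highest weight
  -- vector `w` is a line.
  have hle : lowered (t j i) k v p ≤ ℂ ∙ w := by
    obtain ⟨μ, hμ⟩ := hv.exists_cartan s (finNeg ∘ σ.symm)
    have hsub := hr.lowered_le_eigenspace (j := j) (i := i) hμ k p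
    rw [← cartan_relabel s t σ] at hsub
    have hcomp : (finNeg ∘ σ.symm) ∘ σ = (finNeg : Fin N → ℤ) := by ext; simp
    rw [hcomp] at hsub
    intro y hy
    exact hwt.mem_span hr' ((hsimple.relabel σ).isCyclicVector hw0) finNeg_strictAnti (hsub hwmem)
      (hsub hy)
  have hAw : ∀ r, t i i r w = γ (j, r) • w := fun r => by simpa [ht', hσ] using hγ (j, r)
  have hDw : ∀ r, t j j r w = γ (i, r) • w := fun r => by simpa [ht', hσ] using hγ (i, r)
  have hone : ∀ c, γ (c, 0) = 1 := fun c => by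
    have := hγ (c, 0)
    simp only [hr'.zero_self, Module.End.one_apply] at this
    exact smul_left_injective ℂ hw0 (by simpa using this.symm)
  have hratio : (∏ r, (Polynomial.X + Polynomial.C (a r))) *
        (revPoly k fun r => γ (i, r)).comp (Polynomial.X + Polynomial.C (sgn (s i)))
      = (∏ r, (Polynomial.X + Polynomial.C (b r))) *
        (revPoly k fun r => γ (j, r)).comp (Polynomial.X + Polynomial.C (sgn (s i))) := by
    -- If `p = 0` then `t_{ji}(u) v = 0`, whence `λ_i = λ_j`; by the hypothesis on the roots this
    -- forces `k = 0`.
    rcases Nat.eq_zero_or_pos k with rfl | hk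
    · simp [revPoly, hone]
    rcases p with _ | p
    · exfalso
      obtain ⟨c, rfl⟩ := Submodule.mem_span_singleton.1 hwmem
      have hc : c ≠ 0 := fun h => hw0 (by rw [h, zero_smul])
      have hCv0 : ∀ r, t j i r v = 0 := fun r => by
        have := (hKmem.1 hwK).2 r
        rw [map_smul] at this
        exact (smul_eq_zero.1 this).resolve_left hc
      have heq : lam i = lam j := by
        ext q
        have := hr.odd_bracket hs 0 q v
        simp only [hCv0, map_zero, hv.singular i j _ hlt, hr.zero_self, hv.diag, map_smul,
          Module.End.one_apply, add_zero, sub_zero] at this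
        have := (smul_eq_zero.1 this.symm).resolve_left (neg_ne_zero.2 (sgn_ne_zero _))
        rw [← sub_smul] at this
        exact sub_eq_zero.1 ((smul_eq_zero.1 this).resolve_right hv0)
      rw [hi, hj] at heq
      have h1 := revEval_coeff_linProd a (-a ⟨0, hk⟩)
      rw [heq, revEval_coeff_linProd,
        Finset.prod_eq_zero (f := fun r => -a ⟨0, hk⟩ + a r) (Finset.mem_univ ⟨0, hk⟩)
          (neg_add_cancel _), Finset.prod_eq_zero_iff] at h1
      obtain ⟨q, -, hq⟩ := h1
      exact hab ⟨0, hk⟩ q (by linear_combination -hq)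
    · have := hA.revPoly_ratio hD hC (sgn_ne_zero _) hCv (hv.diag i) hα (hv.diag j) hβ hw0 hwmem
        hle hAw hDw
      rwa [hi, hj, revPoly_coeff_linProd, revPoly_coeff_linProd] at this
  obtain ⟨h1, h2⟩ := eq_coeff_linProd_of_comp_mul_eq hab (hone j)
    (fun r h => (smul_eq_zero.1 ((hAw r).symm.trans
      (hA.apply_eq_zero_of_lt hC hCv (hmem i) (hzero i hα) hwmem h))).resolve_right hw0)
    (fun r h => (smul_eq_zero.1 ((hDw r).symm.trans
      (hD.apply_eq_zero_of_lt hC hCv (hmem j) (hzero j hβ) hwmem h))).resolve_right hw0)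
    _ hratio
  refine ⟨w, hw0, hwt.singular, fun c r => ?_⟩
  unfold reflectedWeight
  by_cases hcj : c = j
  · rw [hcj, Function.update_self]
    simpa [ht', hσ, sub_eq_add_neg, h1 r] using hAw r
  by_cases hci : c = i
  · rw [hci, Function.update_of_ne hlt.ne, Function.update_self]
    simpa [ht', hσ, sub_eq_add_neg, h2 r] using hDw r
  rw [Function.update_of_ne hcj, Function.update_of_ne hci]
  simp only [ht', hσ, Equiv.swap_apply_of_ne_of_ne hci hcj]
  exact hv.diag_lowered hr hcyc hij hci hcj r hwmem

end Rep

/-! ### Modules over the Yangian -/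

section Modules

variable {N : ℕ} {s : Fin N → ZMod 2}

theorem Yangian.induction {P : Yangian s → Prop} (algebraMap : ∀ c : ℂ, P (algebraMap ℂ _ c))
    (t : ∀ i j r, P (Yangian.t s i j r)) (add : ∀ x y, P x → P y → P (x + y))
    (mul : ∀ x y, P x → P y → P (x * y)) (y : Yangian s) : P y := by
  obtain ⟨x, rfl⟩ := RingQuot.mkAlgHom_surjective ℂ (Rel s) y
  induction x using FreeAlgebra.induction with
  | grade0 c => rw [AlgHom.commutes]; exact algebraMap c
  | grade1 x => exact t x.1 x.2.1 (x.2.2 + 1)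
  | add x y hx hy => rw [map_add]; exact add _ _ hx hy
  | mul x y hx hy => rw [map_mul]; exact mul _ _ hx hy

/-- The operators by which the `t_{ij}^{(r)}` act on a module over the Yangian. -/
noncomputable def actionOps (s : Fin N → ZMod 2) (M : Type*) [AddCommGroup M] [Module ℂ M]
    [Module (Yangian s) M] [IsScalarTower ℂ (Yangian s) M] (i j : Fin N) (r : ℕ) :
    Module.End ℂ M :=
  Algebra.lsmul ℂ ℂ M (Yangian.t s i j r)

variable {M : Type*} [AddCommGroup M] [Module ℂ M] [Module (Yangian s) M]
  [IsScalarTower ℂ (Yangian s) M]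

theorem actionOps_apply (i j : Fin N) (r : ℕ) (x : M) :
    actionOps s M i j r x = Yangian.t s i j r • x := rfl

theorem isRep_actionOps (s : Fin N → ZMod 2) (M : Type*) [AddCommGroup M] [Module ℂ M]
    [Module (Yangian s) M] [IsScalarTower ℂ (Yangian s) M] : IsRep s (actionOps s M) where
  zero i j := by
    by_cases h : i = j <;> simp [actionOps, Yangian.t, freeT, h]
  rtt i j k l r q := by
    have := congrArg (Algebra.lsmul ℂ ℂ M) (Yangian.mk_rel (Rel.rtt (s := s) i j k l r q))
    simp only [superComm, map_sub, map_mul, map_smul] at this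
    exact this

theorem IsStable.smul_mem {W : Submodule ℂ M} (hW : IsStable (actionOps s M) W) (y : Yangian s)
    {x : M} (hx : x ∈ W) : y • x ∈ W := by
  induction y using Yangian.induction generalizing x with
  | algebraMap c => rw [algebraMap_smul]; exact W.smul_mem c hx
  | t i j r => exact hW i j r x hx
  | add y z hy hz => rw [add_smul]; exact W.add_mem (hy hx) (hz hx)
  | mul y z hy hz => rw [mul_smul]; exact hy (hz hx)

theorem isSimpleRep_actionOps (h : ∀ P : Submodule (Yangian s) M, P = ⊥ ∨ P = ⊤) :
    IsSimpleRep (actionOps s M) := by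
  intro W hW
  let P : Submodule (Yangian s) M :=
    { W with smul_mem' := fun y _ hx => hW.smul_mem y hx }
  refine (h P).imp (fun hP => ?_) (fun hP => ?_)
  · refine (Submodule.eq_bot_iff _).2 fun x hx => ?_
    have : x ∈ P := hx
    simpa [hP] using this
  · refine Submodule.eq_top_iff'.2 fun x => ?_
    have : x ∈ P := hP ▸ Submodule.mem_top
    exact this

theorem isCyclicVector_actionOps {v : M} (h : ∀ x : M, ∃ y : Yangian s, y • v = x) :
    IsCyclicVector (actionOps s M) v := fun W hW hv =>
  Submodule.eq_top_iff'.2 fun x => by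
    obtain ⟨y, rfl⟩ := h x
    exact hW.smul_mem y hv

/-- The canonical generator of the Verma module. -/
noncomputable def vermaVector (s : Fin N → ZMod 2) (lam : Fin N → ℂ⟦X⟧) : Verma s lam :=
  Submodule.Quotient.mk 1

theorem smul_vermaVector (lam : Fin N → ℂ⟦X⟧) (y : Yangian s) :
    y • vermaVector s lam = Submodule.Quotient.mk y := by
  rw [vermaVector, ← Submodule.Quotient.mk_smul, smul_eq_mul, mul_one]

theorem isHighestWeight_vermaVector (s : Fin N → ZMod 2) (lam : Fin N → ℂ⟦X⟧) :
    IsHighestWeight (actionOps s (Verma s lam)) lam (vermaVector s lam) where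
  singular i j r hij := by
    rw [actionOps_apply, smul_vermaVector, Submodule.Quotient.mk_eq_zero]
    exact Submodule.subset_span (Or.inl ⟨i, j, r, hij, rfl⟩)
  diag i r := by
    rw [actionOps_apply, ← algebraMap_smul (Yangian s) (PowerSeries.coeff r (lam i)),
      smul_vermaVector, smul_vermaVector, Submodule.Quotient.eq]
    exact Submodule.subset_span (Or.inr ⟨i, r, rfl⟩)

/-- In a nonzero Verma module the sum of all proper submodules is proper, since their weights lie
strictly below that of the generator. -/
theorem maxSubmodule_ne_top (lam : Fin N → ℂ⟦X⟧) (h0 : vermaVector s lam ≠ 0) :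
    maxSubmodule s lam ≠ ⊤ := by
  intro htop
  have hv := isHighestWeight_vermaVector s lam
  have hr := isRep_actionOps s (Verma s lam)
  have hcyc : IsCyclicVector (actionOps s (Verma s lam)) (vermaVector s lam) :=
    isCyclicVector_actionOps fun x => by
      obtain ⟨y, rfl⟩ := Submodule.Quotient.mk_surjective _ x
      exact ⟨y, smul_vermaVector lam y⟩
  obtain ⟨μ, hμ⟩ := hv.exists_cartan s finNeg
  refine h0 (Submodule.disjoint_def.1 (disjoint_lower _ μ) _ hμ ?_)
  have hmem : vermaVector s lam ∈ maxSubmodule s lam := htop ▸ Submodule.mem_top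
  rw [maxSubmodule, sSup_eq_iSup'] at hmem
  suffices H : ∀ x ∈ ⨆ P : {P : Submodule (Yangian s) (Verma s lam) | P ≠ ⊤}, P.1,
      x ∈ ⨆ n : ℕ, (cartan s (actionOps s (Verma s lam)) finNeg).eigenspace (μ - (n + 1)) from
    H _ hmem
  intro x hx
  induction hx using Submodule.iSup_induction' with
  | mem P x hx =>
    refine hv.le_lower hr hcyc finNeg_strictAnti hμ (P := P.1.restrictScalars ℂ)
      (fun i j r y hy => P.1.smul_mem _ hy) (fun h => P.2 ?_) hx
    rwa [Submodule.restrictScalars_eq_top_iff] at h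
  | zero => exact Submodule.zero_mem _
  | add x y _ _ hx hy => exact Submodule.add_mem _ hx hy

/-- `L(λ(u))` has no submodules other than `⊥` and `⊤`. The zero module is not excluded here. -/
theorem irrModule_eq_bot_or_eq_top (lam : Fin N → ℂ⟦X⟧)
    (P : Submodule (Yangian s) (IrrModule s lam)) : P = ⊥ ∨ P = ⊤ := by
  refine or_iff_not_imp_right.2 fun hP => ?_
  have hsurj : Function.Surjective (maxSubmodule s lam).mkQ := Submodule.mkQ_surjective _
  have hle : P.comap (maxSubmodule s lam).mkQ ≤ maxSubmodule s lam :=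
    le_sSup fun h => hP (by
      rw [← Submodule.map_comap_eq_of_surjective hsurj P, h, Submodule.map_top,
        LinearMap.range_eq_top.2 hsurj])
  rw [← Submodule.map_comap_eq_of_surjective hsurj P, eq_bot_iff]
  refine (Submodule.map_mono hle).trans ?_
  simp

/-- A simple module `V` with a nonzero vector of highest weight `λ(u)` for the relabelled
generators is `L(λ(u))` up to relabelling. -/
theorem isoViaRelabel_of_isHighestWeight (σ : Equiv.Perm (Fin N)) {V : Type} [AddCommGroup V]
    [Module ℂ V] [Module (Yangian s) V] [IsScalarTower ℂ (Yangian s) V]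
    (hV : ∀ P : Submodule (Yangian s) V, P = ⊥ ∨ P = ⊤) {lam : Fin N → ℂ⟦X⟧} {w : V} (hw0 : w ≠ 0)
    (hw : IsHighestWeight (fun a b r => actionOps s V (σ a) (σ b) r) lam w) :
    IsoViaRelabel s σ V (IrrModule (s ∘ σ) lam) := by
  let ρ : Yangian (s ∘ σ) →+* Yangian s := (relabel s σ : Yangian (s ∘ σ) →+* Yangian s)
  have hρ : ∀ y, ρ y = relabel s σ y := fun _ => rfl
  have hρt : ∀ a b r, ρ (Yangian.t (s ∘ σ) a b r) = Yangian.t s (σ a) (σ b) r := fun a b r =>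
    relabelHom_t s (s ∘ σ) σ _ a b r
  have hρc : ∀ c : ℂ, ρ (algebraMap ℂ _ c) = algebraMap ℂ _ c := (relabel s σ).commutes
  have : RingHomSurjective ρ := ⟨(relabel s σ).surjective⟩
  -- The map `y ↦ ρ(y) w`, semilinear over the relabelling isomorphism, descends to the Verma
  -- module and then to `L(λ(u))`.
  let φ : Yangian (s ∘ σ) →ₛₗ[ρ] V :=
    { toFun := fun y => ρ y • w
      map_add' := fun x y => by rw [map_add, add_smul]
      map_smul' := fun x y => by rw [smul_eq_mul, map_mul, mul_smul] }
  have hφ : ∀ y, φ y = ρ y • w := fun _ => rfl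
  have hker : vermaIdeal (s ∘ σ) lam ≤ LinearMap.ker φ := by
    refine Submodule.span_le.2 ?_
    rintro _ (⟨a, b, r, hab, rfl⟩ | ⟨a, r, rfl⟩)
    · rw [SetLike.mem_coe, LinearMap.mem_ker, hφ, hρt]
      exact hw.singular a b r hab
    · rw [SetLike.mem_coe, LinearMap.mem_ker, map_sub, hφ, hφ, hρt, hρc, algebraMap_smul,
        sub_eq_zero]
      exact hw.diag a r
  let ψ : Verma (s ∘ σ) lam →ₛₗ[ρ] V := (vermaIdeal (s ∘ σ) lam).liftQ φ hker
  have hψ : ∀ y, ψ (Submodule.Quotient.mk y) = ρ y • w := fun _ => rfl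
  have hψv : ψ (vermaVector (s ∘ σ) lam) = w := by
    rw [vermaVector, hψ, map_one, one_smul]
  have hψs : Function.Surjective ψ := by
    intro x
    have hspan : Submodule.span (Yangian s) {w} = ⊤ :=
      (hV _).resolve_left fun h => hw0 (Submodule.span_singleton_eq_bot.1 h)
    obtain ⟨y, rfl⟩ := Submodule.mem_span_singleton.1 (hspan ▸ Submodule.mem_top : x ∈ _)
    obtain ⟨y, rfl⟩ := (relabel s σ).surjective y
    exact ⟨Submodule.Quotient.mk y, hψ y⟩
  have hmax : maxSubmodule (s ∘ σ) lam = LinearMap.ker ψ := by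
    have hle : LinearMap.ker ψ ≤ maxSubmodule (s ∘ σ) lam := le_sSup fun h => hw0 (by
      have : vermaVector (s ∘ σ) lam ∈ LinearMap.ker ψ := h ▸ Submodule.mem_top
      rwa [LinearMap.mem_ker, hψv] at this)
    refine le_antisymm ?_ hle
    rcases hV ((maxSubmodule (s ∘ σ) lam).map ψ) with h | h
    · exact LinearMap.le_ker_iff_map.2 h
    · exfalso
      refine maxSubmodule_ne_top lam (fun h0 => hw0 (by rw [← hψv, h0, map_zero]))
        (Submodule.eq_top_iff'.2 fun x => ?_)
      obtain ⟨y, hy, hyx⟩ := (h ▸ Submodule.mem_top : ψ x ∈ (maxSubmodule (s ∘ σ) lam).map ψ)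
      have : x - y ∈ maxSubmodule (s ∘ σ) lam :=
        hle (by rw [LinearMap.mem_ker, map_sub, hyx, sub_self])
      simpa using Submodule.add_mem _ this hy
  let g : IrrModule (s ∘ σ) lam →ₛₗ[ρ] V := (maxSubmodule (s ∘ σ) lam).liftQ ψ hmax.le
  have hginj : Function.Injective g :=
    LinearMap.ker_eq_bot.1 (Submodule.ker_liftQ_eq_bot _ _ _ hmax.ge)
  have hgsurj : Function.Surjective g := fun x => by
    obtain ⟨y, rfl⟩ := hψs x
    exact ⟨Submodule.Quotient.mk y, rfl⟩
  let g' : IrrModule (s ∘ σ) lam →ₗ[ℂ] V :=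
    { toFun := g
      map_add' := map_add g
      map_smul' := fun c x => by
        rw [← algebraMap_smul (Yangian (s ∘ σ)) c x, map_smulₛₗ, hρc, algebraMap_smul,
          RingHom.id_apply] }
  let e := LinearEquiv.ofBijective g' ⟨hginj, hgsurj⟩
  refine ⟨e.symm, fun y x => ?_⟩
  obtain ⟨x, rfl⟩ := e.surjective x
  rw [e.symm_apply_apply, LinearEquiv.symm_apply_eq]
  exact (map_smulₛₗ g y x).symm

variable {lam : Fin N → ℂ⟦X⟧} {i j : Fin N} {k : ℕ} {a b : Fin k → ℂ}

theorem isoViaRelabel_irrModule_of_nontrivial [Nontrivial (IrrModule s lam)]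
    (hij : (j : ℕ) = (i : ℕ) + 1) (hs : s j = s i + 1) (hi : lam i = linProd a)
    (hj : lam j = linProd b) (hab : ∀ r q, a r ≠ b q) :
    IsoViaRelabel s (Equiv.swap i j) (IrrModule s lam)
      (IrrModule (s ∘ Equiv.swap i j) (reflectedWeight lam i j a b (-sgn (s i)))) := by
  have hsimple := irrModule_eq_bot_or_eq_top (s := s) lam
  let v : IrrModule s lam := Submodule.Quotient.mk (vermaVector s lam)
  have hv : IsHighestWeight (actionOps s (IrrModule s lam)) lam v := by
    have h := isHighestWeight_vermaVector s lam
    constructor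
    · intro a b r hab
      have := congrArg (Submodule.Quotient.mk (p := maxSubmodule s lam)) (h.singular a b r hab)
      exact this
    · intro a r
      exact congrArg (Submodule.Quotient.mk (p := maxSubmodule s lam)) (h.diag a r)
  have hv0 : v ≠ 0 := by
    intro h0
    obtain ⟨x, hx⟩ := exists_ne (0 : IrrModule s lam)
    obtain ⟨x, rfl⟩ := Submodule.Quotient.mk_surjective _ x
    obtain ⟨y, rfl⟩ := Submodule.Quotient.mk_surjective _ x
    refine hx ?_
    rw [← smul_vermaVector, Submodule.Quotient.mk_smul]
    change y • v = 0
    rw [h0, smul_zero]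
  obtain ⟨w, hw0, hw⟩ := hv.exists_reflected (isRep_actionOps s _) (isSimpleRep_actionOps hsimple)
    hv0 hij hs hi hj hab
  exact isoViaRelabel_of_isHighestWeight _ hsimple hw0 hw

/-- Reflecting back with the opposite sign undoes the reflection. -/
theorem reflectedWeight_reflectedWeight (hij : i ≠ j) (hi : lam i = linProd a)
    (hj : lam j = linProd b) (c : ℂ) :
    reflectedWeight (reflectedWeight lam i j a b c) i j (fun r => b r + c) (fun r => a r + c) (-c)
      = lam := by
  funext l
  unfold reflectedWeight
  by_cases hlj : l = j
  · subst hlj; simp [hj]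
  by_cases hli : l = i
  · subst hli; simp [hi, hlj]
  simp [hlj, hli]

/-- The isomorphism for both orders of the parities, the shift being `-(-1)^{s_i}`. -/
theorem isoViaRelabel_irrModule (hij : (j : ℕ) = (i : ℕ) + 1) (hs : s j = s i + 1)
    (hi : lam i = linProd a) (hj : lam j = linProd b) (hab : ∀ r q, a r ≠ b q) :
    IsoViaRelabel s (Equiv.swap i j) (IrrModule s lam)
      (IrrModule (s ∘ Equiv.swap i j) (reflectedWeight lam i j a b (-sgn (s i)))) := by
  have hne : i ≠ j := fun h => by rw [h] at hij; omega
  rcases subsingleton_or_nontrivial (IrrModule s lam) with hL | hL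
  swap
  · exact isoViaRelabel_irrModule_of_nontrivial hij hs hi hj hab
  -- If `L(λ(u)) = 0`, then its reflection is zero as well, because a nonzero one would reflect
  -- back to a nonzero `L(λ(u))`. This spares a proof that Verma modules are nonzero.
  have hL' : Subsingleton
      (IrrModule (s ∘ Equiv.swap i j) (reflectedWeight lam i j a b (-sgn (s i)))) := by
    by_contra hnot
    have := not_subsingleton_iff_nontrivial.1 hnot
    obtain ⟨f, -⟩ := isoViaRelabel_irrModule_of_nontrivial (s := s ∘ Equiv.swap i j)
      (lam := reflectedWeight lam i j a b (-sgn (s i))) (a := fun r => b r + -sgn (s i))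
      (b := fun r => a r + -sgn (s i)) hij
      (by simp [hs, add_assoc, CharTwo.add_self_eq_zero]) (by simp [reflectedWeight, hne])
      (by simp [reflectedWeight])
      (fun r q h => hab q r (add_right_cancel h).symm)
    have h1 : (s ∘ Equiv.swap i j) ∘ Equiv.swap i j = s := by ext l; simp
    have h2 : -sgn ((s ∘ Equiv.swap i j) i) = -(-sgn (s i)) := by simp [hs, sgn_add_one]
    rw [h2, reflectedWeight_reflectedWeight hne hi hj] at f
    have h3 : ∀ s', s' = s → Subsingleton (IrrModule s' lam) := by rintro _ rfl; exact hL
    have := h3 _ h1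
    exact hnot f.toEquiv.subsingleton
  exact ⟨0, fun _ _ => Subsingleton.elim _ _⟩

end Modules

end SuperYangian


theorem corollary4p6 {N : ℕ} (s : Fin N → ZMod 2) (lam : Fin N → PowerSeries ℂ)
    (hlam : ∀ l, PowerSeries.constantCoeff (lam l) = 1)
    (i j : Fin N) (hij : (j : ℕ) = (i : ℕ) + 1)
    (k : ℕ) (a b : Fin k → ℂ)
    (hi : lam i = SuperYangian.linProd a) (hj : lam j = SuperYangian.linProd b)
    (hab : ∀ r q, a r ≠ b q) :
    (s i = 0 → s j = 1 →
      SuperYangian.IsoViaRelabel s (Equiv.swap i j)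
        (SuperYangian.IrrModule s lam)
        (SuperYangian.IrrModule (s ∘ Equiv.swap i j)
          (SuperYangian.reflectedWeight lam i j a b (-1)))) ∧
    (s i = 1 → s j = 0 →
      SuperYangian.IsoViaRelabel s (Equiv.swap i j)
        (SuperYangian.IrrModule s lam)
        (SuperYangian.IrrModule (s ∘ Equiv.swap i j)
          (SuperYangian.reflectedWeight lam i j a b 1))) := by
  constructor
  · intro h0 h1
    have := SuperYangian.isoViaRelabel_irrModule (s := s) hij (by rw [h0, h1, zero_add]) hi hj hab
    rwa [h0, SuperYangian.sgn_zero] at this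
  · intro h1 h0
    have := SuperYangian.isoViaRelabel_irrModule (s := s) hij
      (by rw [h0, h1, CharTwo.add_self_eq_zero]) hi hj hab
    rwa [h1, SuperYangian.sgn_one, neg_neg] at this
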